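/- Let $\mathfrak g$ be a finite-dimensional simple Lie algebra over $\mathbb C$ with an $\mathfrak{sl}_2$-triple $(e,h,f)$, where $f$ is a minimal nilpotent element (a nonzero nilpotent with $[f,[f,\mathfrak g]]\subseteq\mathbb Cf$, i.e. a long root vector). Let $(\cdot,\cdot)$ be the symmetric invariant bilinear form with $(e,f)=1$, $(h,h)=2$; put $x=h/2$ and $\mathfrak g(i)=\{a\in\mathfrak g: [x,a]=ia\}$, and let $d$ be the largest eigenvalue of $\operatorname{ad}x$ (so $d=1$). Fix an integer $m>0$ and $k\in\mathbb C$. Give $az^j$, $a\in\mathfrak g(i)$, $j\ge 0$, the degree $(d+1)j+i$. Let $\mathcal V$ be the algebra of differential polynomials (with derivation $\partial$) in the elements $u_iz^j$ of degree $<(d+1)m+1$, where $\{u_i\}$ is a basis of $\mathfrak g$ of eigenvectors of $\operatorname{ad}x$ and $j\ge0$. Every $az^j$ ($a\in\mathfrak g$, $j\ge0$) is regarded as an element of $\mathcal V$, linearly in $a$, by setting elements of degree $>(d+1)m+1$ to $0$ and an element $az^j$ of degree exactly $(d+1)m+1$ to the constant $-\delta_{j,m}(f,a)-\delta_{j,m+1}(e,a)$;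 thus $ez^m=fz^{m+1}=-1$. The two Poisson $\lambda$-brackets $\mathcal V\times\mathcal V\to\mathcal V[\lambda]$ are determined, via sesquilinearity and the Leibniz rules (master formula), by the values on the variables $$\{az^i{}_\lambda bz^j\}_1=-[a,b]z^{i+j+1},\qquad \{az^i{}_\lambda bz^j\}_2=\begin{cases}[a,b]+k\lambda(a,b), & i=j=0,\\ 0, & \text{exactly one of } i,j \text{ is } 0,\\ -[a,b]z^{i+j}, & i,j>0.\end{cases}$$ Let $\{z_i\}_{i=1}^{2s}$, $\{z_i^*\}_{i=1}^{2s}$ be bases of $\mathfrak g(\tfrac12)$ with $[z_i,z_j^*]=\delta_{ij}e$, and put $z_{2s+1}=x$, $z^*_{2s+1}=e$. For $a\in\mathfrak g$, $j\ge0$ define $$\tilde\eta_m(az^j)=\sum_{l=0}^4\frac1{l!}\sum_{i_1,\dots,i_l=1}^{2s+1}(z_{i_1}z^m)\cdots(z_{i_l}z^m)\,[[\cdots[a,z_{i_1}^*],\cdots],z_{i_l}^*]z^j ,$$ and let $\eta_m$ be linear in $a$ with $\eta_m(az^j)=\tilde\eta_m(az^j)$ if $j>0$ or if $j=0$ and $a\in\bigoplus_{i\ge0}\mathfrak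 g(i)$, and $$\eta_m(w)=\tilde\eta_m(w)-\sum_{i=1}^{2s}(z_i^*,w)\,k\,\partial(z_iz^m)\quad(w\in\mathfrak g(-\tfrac12)),$$ $$\eta_m(f)=\tilde\eta_m(f)-k\,\partial(xz^m)-\tfrac k2\sum_{i=1}^{2s}\partial(z_i^*z^m)(z_iz^m).$$ Write $\mathfrak g'=\bigoplus_{-1/2\le i\le 1}\mathfrak g(i)$. Then the following identities hold in $\mathcal V[\lambda]$. First bracket. Let $a,b\in\mathfrak g$ and $i,j\ge 0$, with $a\in\mathfrak g'$ if $i=0$ and $b\in\mathfrak g'$ if $j=0$. Then \begin{align*} \{\eta_m(f)_\lambda\eta_m(f)\}_1&=-2k\lambda,\\ \{\eta_m(f)_\lambda\eta_m(az^i)\}_1&=-\eta_m([f,a]z^{i+1})+\eta_m([a,e]z^i),\\ \{\eta_m(az^i)_\lambda\eta_m(f)\}_1&=-\eta_m([a,f]z^{i+1})-\eta_m([a,e]z^i),\\ \{\eta_m(az^i)_\lambda\eta_m(bz^j)\}_1&=-\eta_m([a,b]z^{i+j+1}). \end{align*} Second bracket. For all $a,b\in\mathfrak g$ and $u\in\mathfrak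 g'$, \begin{align*} \{\eta_m(a)_\lambda\eta_m(b)\}_2&=\eta_m([a,b])+k\lambda(a,b),\\ \{\eta_m(fz)_\lambda\eta_m(f)\}_2&=-2\eta_m(x)-k\lambda,\\ \{\eta_m(fz)_\lambda\eta_m(u)\}_2&=\eta_m([u,e]),\\ \{\eta_m(fz)_\lambda\eta_m(fz)\}_2&=0, \end{align*} and for $a,b\in\mathfrak g$ and $i,j>0$, with $a\in\mathfrak g'$ if $i=1$ and $b\in\mathfrak g'$ if $j=1$, \begin{align*} \{\eta_m(fz)_\lambda\eta_m(az^i)\}_2&=-\eta_m([f,a]z^{i+1})+\eta_m([a,e]z^i),\\ \{\eta_m(az^i)_\lambda\eta_m(fz)\}_2&=-\eta_m([a,f]z^{i+1})-\eta_m([a,e]z^i),\\ \{\eta_m(az^i)_\lambda\eta_m(bz^j)\}_2&=-\eta_m([a,b]z^{i+j}). \end{align*} -/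

import Mathlib

noncomputable section

namespace FracW

/-- The eigenspace `𝔤(i) = {a | [h/2, a] = i a}` for the eigenvalue `i`. -/
def gradedPiece {𝔤 : Type*} [LieRing 𝔤] [LieAlgebra ℂ 𝔤] (h : 𝔤) (i : ℚ) : Submodule ℂ 𝔤 :=
  Module.End.eigenspace (LieAlgebra.ad ℂ 𝔤 ((1 / 2 : ℂ) • h)) (i : ℂ)

/-- `f` is a minimal nilpotent element of the (simple) Lie algebra `𝔤`: a nonzero ad-nilpotent
element with `[f, [f, 𝔤]] ⊆ ℂ f`. In a simple Lie algebra over `ℂ` these are the long root vectors,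
that is, the elements of the minimal nonzero nilpotent orbit. -/
def IsMinimalNilpotent {𝔤 : Type*} [LieRing 𝔤] [LieAlgebra ℂ 𝔤] (f : 𝔤) : Prop :=
  f ≠ 0 ∧ IsNilpotent (LieAlgebra.ad ℂ 𝔤 f) ∧ ∀ y : 𝔤, ∃ c : ℂ, ⁅f, ⁅f, y⁆⁆ = c • f

/-- The data that are fixed throughout: an `sl₂`-triple `(e, h, f)` in `𝔤` with `f` minimal
nilpotent, the normalized invariant form, a basis `u` of `𝔤` of eigenvectors of `ad h/2`
(with eigenvalues `wt`), the largest eigenvalue `d` of `ad h/2`, and two bases `z`, `zStar` of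
`𝔤(1/2)` with `[z i, zStar j] = δ i j e`. -/
structure MinimalDatum (𝔤 : Type*) [LieRing 𝔤] [LieAlgebra ℂ 𝔤] where
  e : 𝔤
  h : 𝔤
  f : 𝔤
  triple : IsSl2Triple h e f
  minimal : IsMinimalNilpotent f
  /-- The bilinear form `(·, ·)`. -/
  form : LinearMap.BilinForm ℂ 𝔤
  form_symm : ∀ a b, form a b = form b a
  form_inv : ∀ a b c, form ⁅a, b⁆ c = form a ⁅b, c⁆
  form_e_f : form e f = 1
  form_h_h : form h h = 2
  d : ℚ
  d_greatest : IsGreatest {i : ℚ | gradedPiece h i ≠ ⊥} d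
  u : Module.Basis (Fin (Module.finrank ℂ 𝔤)) ℂ 𝔤
  wt : Fin (Module.finrank ℂ 𝔤) → ℚ
  u_mem : ∀ i, u i ∈ gradedPiece h (wt i)
  s : ℕ
  z : Module.Basis (Fin (2 * s)) ℂ (gradedPiece h (1 / 2))
  zStar : Module.Basis (Fin (2 * s)) ℂ (gradedPiece h (1 / 2))
  lie_z_zStar : ∀ i j, ⁅(z i : 𝔤), (zStar j : 𝔤)⁆ = if i = j then e else 0

namespace MinimalDatum

variable {𝔤 : Type*} [LieRing 𝔤] [LieAlgebra ℂ 𝔤] (D : MinimalDatum 𝔤)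

/-- `x = h/2`. -/
def x : 𝔤 := (1 / 2 : ℂ) • D.h

/-- The sum `⨁ 𝔤(i)` over `-1/2 ≤ i ≤ 1`. -/
def geNegHalf : Submodule ℂ 𝔤 :=
  ⨆ i : {i : ℚ // -1 / 2 ≤ i ∧ i ≤ 1}, gradedPiece D.h i

/-- The degree `gr₂` of `u_i z^j`, the eigenvalue of `(d+1) z ∂_z + ad h/2`. -/
def gr₂ (i : Fin (Module.finrank ℂ 𝔤)) (j : ℕ) : ℚ := (D.d + 1) * j + D.wt i

/-- The index set of the basis `{u_i z^j | j ≥ 0, gr₂(u_i z^j) < (d+1)m + 1}`. -/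
def Idx (m : ℕ) : Type :=
  {p : Fin (Module.finrank ℂ 𝔤) × ℕ // D.gr₂ p.1 p.2 < (D.d + 1) * m + 1}

/-- The differential algebra `𝒱_{[d,m]}`: differential polynomials in the variables `u_i z^j`,
`(i, j) ∈ Idx m`. The variable `X (p, n)` stands for the `n`-th derivative of the variable `p`. -/
abbrev V (m : ℕ) : Type := MvPolynomial (D.Idx m × ℕ) ℂ

/-- The derivation `∂` of `𝒱_{[d,m]}`. -/
def del (m : ℕ) : Derivation ℂ (D.V m) (D.V m) :=
  MvPolynomial.mkDerivation ℂ fun q => MvPolynomial.X (q.1, q.2 + 1)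

/-- `χ(a z^j) = (Λ_m, a z^j)` for `Λ_m = -f z^{-m} - e z^{-m-1}`. -/
def chi (m : ℕ) (a : 𝔤) (j : ℕ) : ℂ :=
  (if j = m then -D.form D.f a else 0) + (if j = m + 1 then -D.form D.e a else 0)

/-- The class of `u_i z^j` in `𝒱_{[d,m]}`: a variable if `gr₂ < (d+1)m+1`, the constant
`χ(u_i z^j)` if `gr₂ = (d+1)m+1`, and zero if `gr₂ > (d+1)m+1`. -/
def curBasis (m : ℕ) (i : Fin (Module.finrank ℂ 𝔤)) (j : ℕ) : D.V m :=
  if hlt : D.gr₂ i j < (D.d + 1) * m + 1 then MvPolynomial.X (⟨(i, j), hlt⟩, 0)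
  else if D.gr₂ i j = (D.d + 1) * m + 1 then MvPolynomial.C (D.chi m (D.u i) j)
  else 0

/-- The class of `a z^j` in `𝒱_{[d,m]}`, for `a ∈ 𝔤` and `j ≥ 0`. -/
def cur (m : ℕ) (a : 𝔤) (j : ℕ) : D.V m :=
  ∑ i, MvPolynomial.C (D.u.repr a i) * D.curBasis m i j

/-! ### Poisson `λ`-brackets -/

/-- The operator `λ + ∂` on `𝒱_{[d,m]}[λ]`. -/
def lamDel (m : ℕ) (P : Polynomial (D.V m)) : Polynomial (D.V m) :=
  Polynomial.X * P + P.sum fun n c => Polynomial.monomial n (D.del m c)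

/-- `H(λ + ∂)_→ P = ∑ cₙ (λ + ∂)ⁿ P` for `H(λ) = ∑ cₙ λⁿ`. -/
def arrow (m : ℕ) (H P : Polynomial (D.V m)) : Polynomial (D.V m) :=
  H.sum fun n c => Polynomial.C c * (D.lamDel m)^[n] P

/-- The `λ`-bracket on `𝒱_{[d,m]}` that takes the values `{a_λ b} = H a b` on the variables,
extended by sesquilinearity and the Leibniz rules (the master formula):
`{F_λ G} = ∑ ∂G/∂b^{(n)} (λ+∂)ⁿ {a_{λ+∂} b}_→ (-λ-∂)^l ∂F/∂a^{(l)}`. -/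
def lamBracket (m : ℕ) (H : D.Idx m → D.Idx m → Polynomial (D.V m)) (F G : D.V m) :
    Polynomial (D.V m) :=
  ∑ p ∈ F.vars, ∑ q ∈ G.vars,
    Polynomial.C (MvPolynomial.pderiv q G) *
      (D.lamDel m)^[q.2]
        (D.arrow m (H p.1 q.1)
          ((fun P => -D.lamDel m P)^[p.2] (Polynomial.C (MvPolynomial.pderiv p F))))

/-- `{a z^i _λ b z^j}₁ = -[a, b] z^{i+j+1}` on the variables. -/
def gen₁ (m : ℕ) (p q : D.Idx m) : Polynomial (D.V m) :=
  Polynomial.C (-D.cur m ⁅D.u p.1.1, D.u q.1.1⁆ (p.1.2 + q.1.2 + 1))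

/-- `{a _λ b}₂ = [a, b] + k λ (a, b)`, `{a z^i _λ b z^j}₂ = -[a, b] z^{i+j}` if `i, j > 0`, and
zero if exactly one of `i`, `j` is zero, on the variables. -/
def gen₂ (m : ℕ) (k : ℂ) (p q : D.Idx m) : Polynomial (D.V m) :=
  if p.1.2 = 0 ∧ q.1.2 = 0 then
    Polynomial.C (D.cur m ⁅D.u p.1.1, D.u q.1.1⁆ 0) +
      Polynomial.C (MvPolynomial.C (k * D.form (D.u p.1.1) (D.u q.1.1))) * Polynomial.X
  else if p.1.2 = 0 ∨ q.1.2 = 0 then 0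
  else Polynomial.C (-D.cur m ⁅D.u p.1.1, D.u q.1.1⁆ (p.1.2 + q.1.2))

/-- The first `λ`-bracket on `𝒱_{[d,m]}`. -/
def bracket₁ (m : ℕ) : D.V m → D.V m → Polynomial (D.V m) := D.lamBracket m (D.gen₁ m)

/-- The second `λ`-bracket on `𝒱_{[d,m]}`. -/
def bracket₂ (m : ℕ) (k : ℂ) : D.V m → D.V m → Polynomial (D.V m) := D.lamBracket m (D.gen₂ m k)

/-! ### The generators `η_m` -/

/-- `z_1, …, z_{2s}` and `z_{2s+1} = x`. -/
def zExt : Fin (2 * D.s) ⊕ Unit → 𝔤 := Sum.elim (fun i => (D.z i : 𝔤)) fun _ => D.x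

/-- `z_1^*, …, z_{2s}^*` and `z_{2s+1}^* = e`. -/
def zStarExt : Fin (2 * D.s) ⊕ Unit → 𝔤 := Sum.elim (fun i => (D.zStar i : 𝔤)) fun _ => D.e

/-- The iterated bracket `[[⋯[[a, z_{i_1}^*], z_{i_2}^*], ⋯], z_{i_l}^*]`. -/
def nest (a : 𝔤) {l : ℕ} (I : Fin l → Fin (2 * D.s) ⊕ Unit) : 𝔤 :=
  (List.ofFn I).foldl (fun b i => ⁅b, D.zStarExt i⁆) a

/-- `η̃_m(a z^j)`. -/
def etaTilde (m : ℕ) (a : 𝔤) (j : ℕ) : D.V m :=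
  ∑ l ∈ Finset.range 5, ∑ I : Fin l → Fin (2 * D.s) ⊕ Unit,
    MvPolynomial.C (1 / (l.factorial : ℂ)) * (∏ t, D.cur m (D.zExt (I t)) m) *
      D.cur m (D.nest a I) j

/-- `η_m(a z^j)`. For `j > 0` and for `j = 0`, `a ∈ ⨁_{i ≥ 0} 𝔤(i)` it is `η̃_m(a z^j)`; for `j = 0`
and `a = w ∈ 𝔤(-1/2)` one subtracts `∑ᵢ (z_i^*, w) k ∂(z_i z^m)`, and for `j = 0` and `a = f` one
subtracts `k ∂(x z^m) + (k/2) ∑ᵢ ∂(z_i^* z^m) (z_i z^m)`. These cases are combined linearly: on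
`𝔤`, the functional `(z_i^*, ·)` vanishes outside `𝔤(-1/2)`, while `(e, ·)` vanishes outside
`𝔤(-1) = ℂ f` and `(e, f) = 1`. -/
def eta (m : ℕ) (k : ℂ) (a : 𝔤) (j : ℕ) : D.V m :=
  D.etaTilde m a j -
    if j = 0 then
      (∑ i, MvPolynomial.C (D.form (D.zStar i) a * k) * D.del m (D.cur m (D.z i) m)) +
        MvPolynomial.C (D.form D.e a) *
          (MvPolynomial.C k * D.del m (D.cur m D.x m) +
            MvPolynomial.C (k / 2) *
              ∑ i, D.del m (D.cur m (D.zStar i) m) * D.cur m (D.z i) m)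
    else 0

end MinimalDatum

end FracW

end

/-! ### The grading of `𝔤` and the invariant form -/

noncomputable section

namespace FracW

section Graded

variable {𝔤 : Type*} [LieRing 𝔤] [LieAlgebra ℂ 𝔤]

/-! Over `A = 𝒱`, let `N = -∑ (z_i z^m) ⊗ z_i^*` in the Lie algebra `A ⊗ 𝔤`, the pair `(x, e)`
included (`gauge`). Then `η̃_m(a z^j)` is the image of `exp (ad N) (1 ⊗ a)` under the `A`-linear
extension of `a ↦ a z^j`. The exponential is a polynomial: the weights of `ad x` lie in `[-1, 1]`
and `ad N` raises them by at least `1/2`, so `(ad N)^5 = 0`. It is an automorphism of `A ⊗ 𝔤` that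
preserves the form (`expAd_lie`, `baseChange_expAd`), so the part of the bracket that leaves the
coefficients of `N` alone reproduces `η̃_m([a, b] z^l)`.

The rest comes from brackets with the coefficients of `N`. Brackets with `𝔤(1/2) z^m` either vanish
by definition or land at a level beyond `m`, where only the constant `-(e, ·)` of level `m + 1`
survives; as `e` commutes with `𝔤(1/2)`, these elements are central. The element `x z^m` brackets
with a single level `r` (`0` for the first bracket, `1` for the second), and there it gives `±(e,
a)`. Since `e` commutes with `N`, the derivative of `η̃_m(a z^j)` in the direction of `x z^m` is
`η̃_m([a, e] z^j)` (`derivation_gaugeEta`). Hence the extra terms `(e, a) η̃_m([b, e] z^j)` and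
`-(e, b) η̃_m([a, e] z^i)` (`br_gaugeEta`); as `(e, ·)` vanishes on `𝔤'` and is `1` at `f`, they
explain the exceptional role of `f`.

At level zero of the second bracket the cocycle `kλ(a, b)` also produces `k (∂ exp(ad N) a, exp(ad
N) b) = k (Ξ, [a, b])`, where `Ξ = ∂N - ½[N, ∂N]` is the logarithmic derivative. Pairing with `Ξ`
gives minus the derivative terms of `η_m` (`baseChange_logDer`), so `η_m` is corrected exactly as
needed (`br_eta_of_affine`). In the other brackets the correction acts only through `k ∂(x z^m)` and
yields the multiples of `λ` (`br_eta`).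

The master formula is read as a map from Kähler differentials to derivations (`lamBracket_eq`). Only
sesquilinearity and the Leibniz rules are used; skew-symmetry and the Jacobi identity play no role.
-/

theorem mem_gradedPiece {h a : 𝔤} {i : ℚ} :
    a ∈ gradedPiece h i ↔ ⁅(1 / 2 : ℂ) • h, a⁆ = (i : ℂ) • a := by
  rw [gradedPiece, Module.End.mem_eigenspace_iff, LieAlgebra.ad_apply]

theorem lie_eq_smul_of_mem_gradedPiece {h a : 𝔤} {i : ℚ} (ha : a ∈ gradedPiece h i) :
    ⁅h, a⁆ = (2 * i : ℂ) • a := by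
  rw [mem_gradedPiece, smul_lie] at ha
  rw [mul_smul, ← ha, smul_smul]
  norm_num

theorem lie_mem_gradedPiece {h a b : 𝔤} {i j : ℚ} (ha : a ∈ gradedPiece h i)
    (hb : b ∈ gradedPiece h j) : ⁅a, b⁆ ∈ gradedPiece h (i + j) := by
  rw [mem_gradedPiece] at *
  rw [leibniz_lie, ha, hb, smul_lie, lie_smul, ← add_smul]
  push_cast
  rfl

/-- The lowering operator is injective on positive weight spaces. -/
theorem lie_f_ne_zero [FiniteDimensional ℂ 𝔤] {h e f v : 𝔤} (t : IsSl2Triple h e f) {i : ℚ}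
    (hi : 0 < i) (hv : v ∈ gradedPiece h i) (hv0 : v ≠ 0) : ⁅f, v⁆ ≠ 0 := by
  intro h0
  -- For the opposite triple `v` would be a primitive vector of weight `-2i`, but such weights are
  -- natural numbers.
  have P : IsSl2Triple.HasPrimitiveVectorWith t.symm v (-(2 * i : ℂ)) :=
    ⟨hv0, by rw [neg_lie, lie_eq_smul_of_mem_gradedPiece hv, neg_smul], h0⟩
  obtain ⟨n, hn⟩ := P.exists_nat
  have h1 : -(2 * i) = (n : ℚ) := by exact_mod_cast hn
  have : (0 : ℚ) ≤ n := n.cast_nonneg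
  linarith

end Graded

namespace MinimalDatum

variable {𝔤 : Type*} [LieRing 𝔤] [LieAlgebra ℂ 𝔤] (D : MinimalDatum 𝔤)

theorem e_mem : D.e ∈ gradedPiece D.h 1 := by
  rw [mem_gradedPiece, smul_lie, D.triple.lie_h_e_smul ℂ, smul_smul]
  norm_num

theorem f_mem : D.f ∈ gradedPiece D.h (-1) := by
  rw [mem_gradedPiece, smul_lie, D.triple.lie_lie_smul_f ℂ, smul_neg, smul_smul]
  norm_num

theorem x_mem : D.x ∈ gradedPiece D.h 0 := by
  rw [mem_gradedPiece, x, lie_self]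
  simp

theorem lie_x {a : 𝔤} {i : ℚ} (ha : a ∈ gradedPiece D.h i) : ⁅D.x, a⁆ = (i : ℂ) • a :=
  mem_gradedPiece.1 ha

/-- The `j`-th coordinate is an eigenfunctional for `ad x` with eigenvalue `wt j`. -/
theorem repr_eq_zero {a : 𝔤} {r : ℚ} (ha : a ∈ gradedPiece D.h r)
    {j : Fin (Module.finrank ℂ 𝔤)} (hj : D.wt j ≠ r) : D.u.repr a j = 0 := by
  have key : ∀ b : 𝔤, D.u.repr ⁅D.x, b⁆ j = (D.wt j : ℂ) * D.u.repr b j := by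
    intro b
    have : (D.u.coord j ∘ₗ (LieAlgebra.ad ℂ 𝔤 D.x : 𝔤 →ₗ[ℂ] 𝔤)) = (D.wt j : ℂ) • D.u.coord j := by
      refine D.u.ext fun i => ?_
      simp only [LinearMap.comp_apply, LieAlgebra.ad_apply, D.lie_x (D.u_mem i), map_smul,
        LinearMap.smul_apply, Module.Basis.coord_apply, Module.Basis.repr_self, smul_eq_mul]
      by_cases h : i = j
      · rw [h]
      · simp [Finsupp.single_eq_of_ne' h]
    simpa using LinearMap.congr_fun this b
  have h1 := key a
  rw [D.lie_x ha, map_smul, Finsupp.smul_apply, smul_eq_mul] at h1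
  have h2 : ((r : ℂ) - D.wt j) * D.u.repr a j = 0 := by rw [sub_mul, h1, sub_self]
  rcases mul_eq_zero.1 h2 with h3 | h3
  · exact absurd (by exact_mod_cast (sub_eq_zero.1 h3).symm) hj
  · exact h3

theorem form_lie_left (a b c : 𝔤) : D.form ⁅a, b⁆ c = -D.form b ⁅a, c⁆ := by
  rw [← lie_skew, map_neg, LinearMap.neg_apply, D.form_inv]

theorem form_eq_zero {a b : 𝔤} {i j : ℚ} (ha : a ∈ gradedPiece D.h i)
    (hb : b ∈ gradedPiece D.h j) (hij : i + j ≠ 0) : D.form a b = 0 := by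
  have h1 := D.form_lie_left D.x a b
  rw [D.lie_x ha, D.lie_x hb, map_smul, map_smul, LinearMap.smul_apply, smul_eq_mul,
    smul_eq_mul] at h1
  have h2 : ((i : ℂ) + j) * D.form a b = 0 := by linear_combination h1
  rcases mul_eq_zero.1 h2 with h3 | h3
  · exact absurd (by exact_mod_cast h3) hij
  · exact h3

/-- The radical of the form, an ideal. -/
def radical : LieIdeal ℂ 𝔤 where
  __ := LinearMap.ker D.form
  lie_mem {y a} ha := by
    have ha' : D.form a = 0 := ha
    change D.form ⁅y, a⁆ = 0
    ext b
    rw [D.form_lie_left, ha']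
    simp

theorem form_nondegenerate [LieAlgebra.IsSimple ℂ 𝔤] {a : 𝔤} (ha : ∀ b, D.form a b = 0) :
    a = 0 := by
  rcases LieAlgebra.IsSimple.eq_bot_or_eq_top D.radical with h | h
  · have : a ∈ D.radical := LinearMap.ext ha
    rw [h] at this
    simpa using this
  · have : D.e ∈ D.radical := by rw [h]; trivial
    have h0 : D.form D.e = 0 := this
    have := D.form_e_f
    rw [h0] at this
    simp at this

variable [FiniteDimensional ℂ 𝔤]

/-- This is where minimality of `f` enters. If `a ≠ 0` has weight `i > 1`, lowering twice stays
nonzero; the result has weight `i - 2` and is a multiple of `f`, of weight `-1`, which forces `i =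
1`. -/
theorem eq_zero_of_one_lt {a : 𝔤} {i : ℚ} (hi : 1 < i) (ha : a ∈ gradedPiece D.h i) :
    a = 0 := by
  by_contra h0
  have h1 := lie_f_ne_zero D.triple (by linarith) ha h0
  have m1 := lie_mem_gradedPiece D.f_mem ha
  have h2 := lie_f_ne_zero D.triple (by linarith) m1 h1
  have m2 := lie_mem_gradedPiece D.f_mem m1
  obtain ⟨c, hc⟩ := D.minimal.2.2 a
  have m3 := Submodule.smul_mem _ c D.f_mem
  rw [← hc] at m3
  have e1 := D.lie_x m2
  rw [D.lie_x m3] at e1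
  have e2 := smul_left_injective ℂ h2 e1
  have e3 : (-1 : ℚ) = -1 + (-1 + i) := by exact_mod_cast e2
  linarith

theorem wt_le_one (i : Fin (Module.finrank ℂ 𝔤)) : D.wt i ≤ 1 := by
  by_contra! h
  exact D.u.ne_zero i (D.eq_zero_of_one_lt h (D.u_mem i))

theorem d_eq_one : D.d = 1 := by
  refine le_antisymm ?_ (D.d_greatest.2 ?_)
  · by_contra! h
    exact D.d_greatest.1 ((Submodule.eq_bot_iff _).2 fun a ha => D.eq_zero_of_one_lt h ha)
  · intro h
    have := D.e_mem
    rw [h] at this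
    exact D.triple.e_ne_zero (by simpa using this)

variable [LieAlgebra.IsSimple ℂ 𝔤]

/-- The form pairs weight `i` only with `-i > 1`, which does not occur, and it is nondegenerate
because `𝔤` is simple. -/
theorem eq_zero_of_lt_neg_one {a : 𝔤} {i : ℚ} (hi : i < -1) (ha : a ∈ gradedPiece D.h i) :
    a = 0 := by
  refine D.form_nondegenerate fun b => ?_
  have : D.form a = 0 := D.u.ext fun j => by
    have := D.wt_le_one j
    rw [D.form_eq_zero ha (D.u_mem j) (by linarith), LinearMap.zero_apply]
  rw [this, LinearMap.zero_apply]

theorem neg_one_le_wt (i : Fin (Module.finrank ℂ 𝔤)) : -1 ≤ D.wt i := by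
  by_contra! h
  exact D.u.ne_zero i (D.eq_zero_of_lt_neg_one h (D.u_mem i))

end MinimalDatum

end FracW

end

/-! ### Truncation: the classes `a z^j` at and beyond level `m` -/

noncomputable section

namespace FracW

namespace MinimalDatum

variable {𝔤 : Type*} [LieRing 𝔤] [LieAlgebra ℂ 𝔤] (D : MinimalDatum 𝔤) (m : ℕ)

/-- `cur` as a linear map of its argument in `𝔤`. -/
def curₗ (j : ℕ) : 𝔤 →ₗ[ℂ] D.V m where
  toFun a := D.cur m a j
  map_add' a b := by simp [cur, add_mul, Finset.sum_add_distrib]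
  map_smul' c a := by
    simp [cur, Finset.smul_sum, MvPolynomial.smul_eq_C_mul, mul_assoc]

theorem curₗ_apply (j : ℕ) (a : 𝔤) : D.curₗ m j a = D.cur m a j := rfl

theorem cur_u (i : Fin (Module.finrank ℂ 𝔤)) (j : ℕ) : D.cur m (D.u i) j = D.curBasis m i j := by
  classical
  rw [cur, Finset.sum_eq_single i]
  · simp
  · intro b _ hb
    simp [Finsupp.single_eq_of_ne hb]
  · simp

theorem cur_u_of_lt {i : Fin (Module.finrank ℂ 𝔤)} {j : ℕ}
    (h : D.gr₂ i j < (D.d + 1) * m + 1) :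
    D.cur m (D.u i) j = MvPolynomial.X (⟨(i, j), h⟩, 0) := by
  rw [cur_u, curBasis, dif_pos h]

theorem cur_u_of_not_lt {i : Fin (Module.finrank ℂ 𝔤)} {j : ℕ}
    (h : ¬ D.gr₂ i j < (D.d + 1) * m + 1) :
    ∃ c : ℂ, D.cur m (D.u i) j = MvPolynomial.C c := by
  rw [cur_u, curBasis, dif_neg h]
  split_ifs
  · exact ⟨_, rfl⟩
  · exact ⟨0, by simp⟩

variable [FiniteDimensional ℂ 𝔤]

theorem lie_e_half {w : 𝔤} (hw : w ∈ gradedPiece D.h (1 / 2)) : ⁅D.e, w⁆ = 0 :=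
  D.eq_zero_of_one_lt (by norm_num) (lie_mem_gradedPiece D.e_mem hw)

variable [LieAlgebra.IsSimple ℂ 𝔤]

theorem cur_eq_zero {j : ℕ} (hj : m + 2 ≤ j) (a : 𝔤) : D.cur m a j = 0 := by
  have hj' : (m + 2 : ℚ) ≤ j := by exact_mod_cast hj
  refine Finset.sum_eq_zero fun i _ => ?_
  have := D.neg_one_le_wt i
  rw [curBasis, dif_neg, if_neg, mul_zero] <;> rw [gr₂, D.d_eq_one] <;> linarith

/-- With `d = 1`, the degree `2(m + 1) + wt` is at least `2m + 1`, with equality exactly on `𝔤(-1)`;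
elsewhere `(e, ·)` vanishes as well. -/
theorem cur_succ (a : 𝔤) : D.cur m a (m + 1) = MvPolynomial.C (-D.form D.e a) := by
  suffices D.curₗ m (m + 1) = -(Algebra.linearMap ℂ (D.V m) ∘ₗ D.form D.e) by
    simpa [curₗ_apply] using LinearMap.congr_fun this a
  refine D.u.ext fun i => ?_
  have h1 := D.neg_one_le_wt i
  rw [curₗ_apply, cur_u, curBasis, dif_neg (by rw [gr₂, D.d_eq_one]; push_cast; linarith)]
  by_cases h : D.wt i = -1
  · rw [if_pos (by rw [gr₂, D.d_eq_one, h]; push_cast; ring)]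
    simp [chi, MvPolynomial.algebraMap_eq]
  · rw [if_neg]
    · simp [D.form_eq_zero D.e_mem (D.u_mem i) (fun h0 => h (by linarith))]
    · intro h0
      apply h
      rw [gr₂, D.d_eq_one] at h0
      push_cast at h0
      linarith

/-- Elements that are constants in `𝒱` must have zero bracket for the values on variables to extend
bilinearly. The only delicate case is `n = m`, `l = m + 1`: then `u_i` has weight `1`, commutes with
`e`, and `(e, [u_i, b]) = ([e, u_i], b) = 0`. -/
theorem cur_lie_eq_zero {i : Fin (Module.finrank ℂ 𝔤)} {n l : ℕ}
    (h : ¬ D.gr₂ i n < (D.d + 1) * m + 1) (hl : n < l) (b : 𝔤) :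
    D.cur m ⁅D.u i, b⁆ l = 0 := by
  rw [gr₂, D.d_eq_one, not_lt] at h
  have h1 := D.wt_le_one i
  have hn : m ≤ n := by
    have : (m : ℚ) ≤ n := by linarith
    exact_mod_cast this
  rcases Nat.lt_or_ge (m + 1) l with h2 | h2
  · exact D.cur_eq_zero m h2 _
  · obtain rfl : l = m + 1 := by omega
    obtain rfl : n = m := by omega
    have : ⁅D.e, D.u i⁆ = 0 :=
      D.eq_zero_of_one_lt (by linarith) (lie_mem_gradedPiece D.e_mem (D.u_mem i))
    rw [cur_succ, ← D.form_inv, this]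
    simp

theorem cur_lie_half {w : 𝔤} (hw : w ∈ gradedPiece D.h (1 / 2)) (a : 𝔤) {l : ℕ} (hl : m < l) :
    D.cur m ⁅w, a⁆ l = 0 := by
  rcases Nat.lt_or_ge (m + 1) l with h2 | h2
  · exact D.cur_eq_zero m h2 _
  · obtain rfl : l = m + 1 := by omega
    rw [cur_succ, ← D.form_inv, D.lie_e_half hw]
    simp

theorem cur_lie_x (a : 𝔤) : D.cur m ⁅D.x, a⁆ (m + 1) = MvPolynomial.C (D.form D.e a) := by
  rw [cur_succ, ← D.form_inv, ← lie_skew, D.lie_x D.e_mem]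
  simp

end MinimalDatum

end FracW

end

/-! ### The master formula through Kähler differentials -/

noncomputable section

namespace FracW

/-- A derivation of a polynomial algebra is determined by its values on the variables. -/
theorem derivation_eq_sum_vars {σ R A : Type*} [CommRing R] [AddCommGroup A] [Module R A]
    [Module (MvPolynomial σ R) A] [IsScalarTower R (MvPolynomial σ R) A]
    (δ : Derivation R (MvPolynomial σ R) A) (F : MvPolynomial σ R) :
    δ F = ∑ p ∈ F.vars, MvPolynomial.pderiv p F • δ (MvPolynomial.X p) := by
  classical
  let δ' : σ → Derivation R (MvPolynomial σ R) A := fun p =>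
    (LinearMap.toSpanSingleton (MvPolynomial σ R) A (δ (MvPolynomial.X p))).compDer
      (MvPolynomial.pderiv p)
  have hsum : ∀ G, (∑ p ∈ F.vars, δ' p) G = ∑ p ∈ F.vars, δ' p G := fun G => by
    have := congrFun (map_sum (Derivation.coeFnAddMonoidHom (R := R) (A := MvPolynomial σ R)
      (M := A)) δ' F.vars) G
    rwa [Finset.sum_apply] at this
  rw [MvPolynomial.derivation_eq_of_forall_mem_vars (f := F) (D₁ := δ)
    (D₂ := ∑ p ∈ F.vars, δ' p) fun i hi => ?_, hsum]
  · simp [δ']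
  · rw [hsum, Finset.sum_eq_single i]
    · simp [δ']
    · intro p _ hp
      simp [δ', MvPolynomial.pderiv_X_of_ne hp.symm]
    · exact fun h => absurd hi h

namespace MinimalDatum

variable {𝔤 : Type*} [LieRing 𝔤] [LieAlgebra ℂ 𝔤] (D : MinimalDatum 𝔤) (m : ℕ)

open Polynomial in
theorem coeff_lamDel (P : Polynomial (D.V m)) (n : ℕ) :
    (D.lamDel m P).coeff n = (X * P).coeff n + D.del m (P.coeff n) := by
  rw [lamDel, coeff_add, Polynomial.sum, finsetSum_coeff]
  congr 1
  rw [Finset.sum_eq_single n]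
  · simp
  · intro b _ hb
    rw [coeff_monomial, if_neg hb]
  · intro h
    rw [notMem_support_iff.1 h]
    simp

/-- `λ + ∂` as a linear map. -/
def lamDelₗ : Module.End ℂ (Polynomial (D.V m)) where
  toFun := D.lamDel m
  map_add' P Q := by
    ext1 n
    rw [Polynomial.coeff_add, coeff_lamDel, coeff_lamDel, coeff_lamDel, mul_add,
      Polynomial.coeff_add, Polynomial.coeff_add, map_add]
    ring
  map_smul' c P := by
    ext1 n
    simp only [coeff_lamDel, RingHom.id_apply, Polynomial.coeff_smul, mul_smul_comm,
      Derivation.map_smul, smul_add]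

theorem lamDelₗ_apply (P : Polynomial (D.V m)) : D.lamDelₗ m P = D.lamDel m P := rfl

theorem lamDelₗ_C_mul (v : D.V m) (P : Polynomial (D.V m)) :
    D.lamDelₗ m (Polynomial.C v * P) =
      Polynomial.C v * D.lamDelₗ m P + Polynomial.C (D.del m v) * P := by
  ext1 n
  rw [Polynomial.coeff_add, Polynomial.coeff_C_mul, Polynomial.coeff_C_mul, lamDelₗ_apply,
    lamDelₗ_apply, coeff_lamDel, coeff_lamDel, Polynomial.coeff_C_mul, Derivation.leibniz,
    mul_left_comm, Polynomial.coeff_C_mul, smul_eq_mul, smul_eq_mul]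
  ring

theorem lamDelₗ_X_mul (P : Polynomial (D.V m)) :
    D.lamDelₗ m (Polynomial.X * P) = Polynomial.X * D.lamDelₗ m P := by
  ext1 n
  cases n <;> simp [lamDelₗ_apply, coeff_lamDel]

theorem lamDelₗ_C (v : D.V m) :
    D.lamDelₗ m (Polynomial.C v) = Polynomial.X * Polynomial.C v + Polynomial.C (D.del m v) := by
  ext1 n
  rw [lamDelₗ_apply, coeff_lamDel, Polynomial.coeff_add]
  congr 1
  rw [Polynomial.coeff_C, Polynomial.coeff_C]
  split_ifs <;> simp

theorem pow_lamDelₗ_X_mul (n : ℕ) (P : Polynomial (D.V m)) :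
    (D.lamDelₗ m ^ n) (Polynomial.X * P) = Polynomial.X * (D.lamDelₗ m ^ n) P := by
  induction n generalizing P with
  | zero => rfl
  | succ n ih => rw [pow_succ, Module.End.mul_apply, Module.End.mul_apply, lamDelₗ_X_mul, ih]

/-- `P ↦ H(λ + ∂)_→ P` as a linear map. -/
def arrowₗ (H : Polynomial (D.V m)) : Module.End ℂ (Polynomial (D.V m)) :=
  ∑ n ∈ H.support,
    LinearMap.mulLeft ℂ (Polynomial.C (H.coeff n)) * D.lamDelₗ m ^ n

theorem arrowₗ_apply (H P : Polynomial (D.V m)) : D.arrowₗ m H P = D.arrow m H P := by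
  simp only [arrowₗ, arrow, Polynomial.sum, LinearMap.sum_apply, Module.End.mul_apply,
    LinearMap.mulLeft_apply, Module.End.pow_apply]
  rfl

theorem arrowₗ_X_mul (H P : Polynomial (D.V m)) :
    D.arrowₗ m H (Polynomial.X * P) = Polynomial.X * D.arrowₗ m H P := by
  simp only [arrowₗ, LinearMap.sum_apply, Module.End.mul_apply, LinearMap.mulLeft_apply,
    pow_lamDelₗ_X_mul, Finset.mul_sum, mul_left_comm]

theorem arrowₗ_C (v : D.V m) :
    D.arrowₗ m (Polynomial.C v) = LinearMap.mulLeft ℂ (Polynomial.C v) := by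
  refine LinearMap.ext fun P => ?_
  rw [arrowₗ_apply, arrow, Polynomial.sum_C_index] <;> simp

theorem arrowₗ_zero : D.arrowₗ m 0 = 0 := by simp [arrowₗ]

theorem arrowₗ_C_add (v w : D.V m) :
    D.arrowₗ m (Polynomial.C v + Polynomial.C w * Polynomial.X) =
      LinearMap.mulLeft ℂ (Polynomial.C v) +
        LinearMap.mulLeft ℂ (Polynomial.C w) * D.lamDelₗ m := by
  refine LinearMap.ext fun P => ?_
  rw [arrowₗ_apply, arrow, Polynomial.sum_add_index, Polynomial.sum_C_index,
    Polynomial.C_mul_X_eq_monomial, Polynomial.sum_monomial_index]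
  · simp [lamDelₗ_apply]
  · simp
  · simp
  · simp
  · intro n a b
    rw [Polynomial.C_add, add_mul]

/-- The module of Kähler differentials of `𝒱`, free on the differentials of the variables. -/
abbrev Kahler : Type := D.Idx m × ℕ →₀ D.V m

/-- The universal derivation. -/
def dK : Derivation ℂ (D.V m) (D.Kahler m) :=
  MvPolynomial.mkDerivation ℂ fun p => Finsupp.single p 1

theorem dK_X (p : D.Idx m × ℕ) : D.dK m (MvPolynomial.X p) = Finsupp.single p 1 :=
  MvPolynomial.mkDerivation_X _ _ _

theorem del_X (p : D.Idx m × ℕ) :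
    D.del m (MvPolynomial.X p) = MvPolynomial.X (p.1, p.2 + 1) :=
  MvPolynomial.mkDerivation_X _ _ _

/-- The derivation of the Kähler differentials that is induced by `∂`. -/
def delK : D.Kahler m →ₗ[ℂ] D.Kahler m :=
  Finsupp.lsum ℂ fun p =>
    (Finsupp.lsingle p ∘ₗ (D.del m : D.V m →ₗ[ℂ] D.V m)) + Finsupp.lsingle (p.1, p.2 + 1)

theorem delK_single (p : D.Idx m × ℕ) (v : D.V m) :
    D.delK m (Finsupp.single p v) =
      Finsupp.single p (D.del m v) + Finsupp.single (p.1, p.2 + 1) v := by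
  simp [delK]

theorem delK_smul (v : D.V m) (ω : D.Kahler m) :
    D.delK m (v • ω) = v • D.delK m ω + D.del m v • ω := by
  induction ω using Finsupp.induction_linear with
  | zero => simp
  | add f g hf hg => rw [smul_add, map_add, hf, hg, map_add, smul_add, smul_add]; abel
  | single p w =>
    rw [Finsupp.smul_single, delK_single, delK_single, smul_add, Finsupp.smul_single,
      Finsupp.smul_single, Finsupp.smul_single, smul_eq_mul, Derivation.leibniz,
      Finsupp.single_add, smul_eq_mul, smul_eq_mul, smul_eq_mul, mul_comm w]
    abel

theorem dK_del (F : D.V m) : D.dK m (D.del m F) = D.delK m (D.dK m F) := by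
  induction F using MvPolynomial.induction_on with
  | C c => simp [MvPolynomial.derivation_C]
  | add f g hf hg => simp only [map_add, hf, hg]
  | mul_X f p hf =>
    have hX : D.dK m (D.del m (MvPolynomial.X p)) = D.delK m (D.dK m (MvPolynomial.X p)) := by
      rw [del_X, dK_X, dK_X, delK_single]
      simp
    rw [Derivation.leibniz, map_add, smul_eq_mul, smul_eq_mul, Derivation.leibniz,
      Derivation.leibniz, Derivation.leibniz, map_add, delK_smul, delK_smul, hf, hX]
    abel

variable (H : D.Idx m → D.Idx m → Polynomial (D.V m))

/-- The value at `ω` and the variable `q` of the `λ`-bracket, as a linear function of `ω`. -/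
def bracketVar (q : D.Idx m) : D.Kahler m →ₗ[ℂ] Polynomial (D.V m) :=
  Finsupp.lsum ℂ fun p =>
    -- The coefficient sits under the powers of `-(λ + ∂)`, so the map is only `ℂ`-linear in the
    -- differential, not `𝒱`-linear.
    D.arrowₗ m (H p.1 q) ∘ₗ ((-D.lamDelₗ m) ^ p.2 : Module.End ℂ (Polynomial (D.V m))) ∘ₗ
      (Algebra.linearMap (D.V m) (Polynomial (D.V m))).restrictScalars ℂ

theorem bracketVar_single (q : D.Idx m) (p : D.Idx m × ℕ) (v : D.V m) :
    D.bracketVar m H q (Finsupp.single p v) =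
      D.arrowₗ m (H p.1 q) (((-D.lamDelₗ m) ^ p.2) (Polynomial.C v)) := by
  simp [bracketVar]

/-- The `λ`-bracket as a function of the differential of its first argument, with values in the
derivations of its second argument. -/
def bracketDer : D.Kahler m →ₗ[ℂ] Derivation ℂ (D.V m) (Polynomial (D.V m)) :=
  (MvPolynomial.mkDerivationEquiv ℂ).toLinearMap ∘ₗ
    LinearMap.pi fun q => (D.lamDelₗ m ^ q.2) ∘ₗ D.bracketVar m H q.1

theorem bracketDer_X (ω : D.Kahler m) (q : D.Idx m × ℕ) :
    D.bracketDer m H ω (MvPolynomial.X q) = (D.lamDelₗ m ^ q.2) (D.bracketVar m H q.1 ω) :=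
  MvPolynomial.mkDerivation_X _ _ _

/-- The sums over `F.vars` and `G.vars` expand the derivations `dK` and `bracketDer`; afterwards no
supports have to be tracked. -/
theorem lamBracket_eq (F G : D.V m) :
    D.lamBracket m H F G = D.bracketDer m H (D.dK m F) G := by
  rw [lamBracket, Finset.sum_comm, derivation_eq_sum_vars _ G]
  refine Finset.sum_congr rfl fun q _ => ?_
  rw [bracketDer_X, derivation_eq_sum_vars (D.dK m) F, map_sum, map_sum, Finset.smul_sum]
  refine Finset.sum_congr rfl fun p _ => ?_
  rw [dK_X, Finsupp.smul_single, smul_eq_mul, mul_one, bracketVar_single, Polynomial.smul_eq_C_mul,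
    arrowₗ_apply, Module.End.pow_apply, Module.End.pow_apply]
  rfl

/-- Sesquilinearity in the second argument. -/
theorem bracketDer_del (ω : D.Kahler m) (G : D.V m) :
    D.bracketDer m H ω (D.del m G) = D.lamDelₗ m (D.bracketDer m H ω G) := by
  induction G using MvPolynomial.induction_on with
  | C c => simp [MvPolynomial.derivation_C]
  | add f g hf hg => simp only [map_add, hf, hg]
  | mul_X f p hf =>
    have hX : D.bracketDer m H ω (D.del m (MvPolynomial.X p)) =
        D.lamDelₗ m (D.bracketDer m H ω (MvPolynomial.X p)) := by
      rw [del_X, bracketDer_X, bracketDer_X, pow_succ', Module.End.mul_apply]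
    rw [Derivation.leibniz, map_add, smul_eq_mul, smul_eq_mul, Derivation.leibniz,
      Derivation.leibniz, Derivation.leibniz, map_add, hf, hX]
    simp only [Polynomial.smul_eq_C_mul, lamDelₗ_C_mul]
    abel

theorem neg_pow_lamDelₗ_X_mul (n : ℕ) (P : Polynomial (D.V m)) :
    ((-D.lamDelₗ m) ^ n) (Polynomial.X * P) = Polynomial.X * ((-D.lamDelₗ m) ^ n) P := by
  induction n generalizing P with
  | zero => rfl
  | succ n ih =>
    rw [pow_succ, Module.End.mul_apply, Module.End.mul_apply, LinearMap.neg_apply, lamDelₗ_X_mul,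
      show -(Polynomial.X * D.lamDelₗ m P) = Polynomial.X * (-D.lamDelₗ m) P from
        by rw [LinearMap.neg_apply]; ring, ih]

/-- On `v dp` the two summands of `delK` cancel up to a factor: one more power of `-(λ + ∂)` applied
to `v` is `-λv - ∂v`, and the first summand contributes `∂v`. -/
theorem bracketVar_delK (q : D.Idx m) (ω : D.Kahler m) :
    D.bracketVar m H q (D.delK m ω) = -(Polynomial.X * D.bracketVar m H q ω) := by
  induction ω using Finsupp.induction_linear with
  | zero => simp
  | add f g hf hg => rw [map_add, map_add, hf, hg, map_add, mul_add]; abel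
  | single p v =>
    rw [delK_single, map_add, bracketVar_single, bracketVar_single, bracketVar_single, pow_succ,
      Module.End.mul_apply, LinearMap.neg_apply, lamDelₗ_C, neg_add, map_add, map_add, map_neg,
      map_neg, map_neg, map_neg, neg_pow_lamDelₗ_X_mul, arrowₗ_X_mul]
    abel

theorem bracketDer_delK (ω : D.Kahler m) (G : D.V m) :
    D.bracketDer m H (D.delK m ω) G = -(Polynomial.X * D.bracketDer m H ω G) := by
  -- Both sides are derivations in `G`, so it suffices to compare them on the variables.
  have : D.bracketDer m H (D.delK m ω) =
      (-LinearMap.lsmul (Polynomial (D.V m)) _ Polynomial.X |>.restrictScalars (D.V m)).compDer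
        (D.bracketDer m H ω) := by
    refine MvPolynomial.derivation_ext fun q => ?_
    rw [bracketDer_X, bracketVar_delK, map_neg, pow_lamDelₗ_X_mul]
    simp [bracketDer_X]
  rw [this]
  simp

end MinimalDatum

end FracW

end

/-! ### Exponentials of `ad N` on `A ⊗ L` and their derivatives -/

noncomputable section

namespace FracW

open scoped TensorProduct

/-- A bilinear map that intertwines a derivation-like operator with another nilpotent operator
intertwines the exponentials. -/
theorem bilinear_exp {R M N : Type*} [CommRing R] [AddCommGroup M] [Module R M] [AddCommGroup N]
    [Module R N] [Module ℚ M] [Module ℚ N] (B : M →ₗ[R] M →ₗ[R] N) {S : Module.End R M}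
    {T : Module.End R N} (hS : IsNilpotent S) (hT : IsNilpotent T)
    (h : ∀ a b, T (B a b) = B (S a) b + B a (S b)) (a b : M) :
    IsNilpotent.exp T (B a b) = B (IsNilpotent.exp S a) (IsNilpotent.exp S b) := by
  -- On `M ⊗ M` the hypothesis says that `B` intertwines `S ⊗ 1 + 1 ⊗ S` with `T`; the two summands
  -- commute, so the exponential factors.
  let SL : Module.End R (M ⊗[R] M) := S.lTensor M
  let SR : Module.End R (M ⊗[R] M) := S.rTensor M
  have hL : IsNilpotent SL := hS.map <| Module.End.lTensorAlgHom R M M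
  have hR : IsNilpotent SR := hS.map <| Module.End.rTensorAlgHom R M M
  have hc : Commute SL SR := by ext; simp [SL, SR]
  have h₁ : IsNilpotent.exp T ∘ₗ TensorProduct.lift B =
      TensorProduct.lift B ∘ₗ IsNilpotent.exp (SL + SR) := by
    apply Module.End.commute_exp_left_of_commute (hc.isNilpotent_add hL hR) hT
    ext a b
    simp [SL, SR, h, add_comm]
  have h₂ : IsNilpotent.exp SL = (IsNilpotent.exp S).lTensor M :=
    (hS.map_exp (Module.End.lTensorAlgHom R M M)).symm
  have h₃ : IsNilpotent.exp SR = (IsNilpotent.exp S).rTensor M :=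
    (hS.map_exp (Module.End.rTensorAlgHom R M M)).symm
  have := LinearMap.congr_fun h₁ (a ⊗ₜ b)
  rw [IsNilpotent.exp_add_of_commute hc hL hR, h₂, h₃] at this
  simpa using this

section Exp

variable {A L : Type*} [CommRing A] [Algebra ℂ A] [LieRing L] [LieAlgebra ℂ L] {N : A ⊗[ℂ] L}

theorem baseChange_lie (B : LinearMap.BilinForm ℂ L) (hB : ∀ a b c, B ⁅a, b⁆ c = B a ⁅b, c⁆)
    (ξ ζ χ : A ⊗[ℂ] L) : B.baseChange A ⁅ξ, ζ⁆ χ = B.baseChange A ξ ⁅ζ, χ⁆ := by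
  induction ξ using TensorProduct.induction_on with
  | zero => simp
  | add ξ ξ' h h' => rw [add_lie, map_add, map_add, LinearMap.add_apply, LinearMap.add_apply, h, h']
  | tmul u a =>
    induction ζ using TensorProduct.induction_on with
    | zero => simp
    | add ζ ζ' h h' => rw [lie_add, add_lie, map_add, map_add, LinearMap.add_apply, h, h']
    | tmul v b =>
      induction χ using TensorProduct.induction_on with
      | zero => simp
      | add χ χ' h h' => rw [lie_add, map_add, map_add, h, h']
      | tmul w c => simp [LinearMap.BilinForm.baseChange_tmul, hB, mul_assoc]

/-- A derivation of `A`, acting on `A ⊗ L`. -/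
def derTensor (δ : Derivation ℂ A A) : A ⊗[ℂ] L →ₗ[ℂ] A ⊗[ℂ] L :=
  (δ : A →ₗ[ℂ] A).rTensor L

theorem derTensor_tmul (δ : Derivation ℂ A A) (v : A) (a : L) :
    derTensor δ (v ⊗ₜ[ℂ] a) = δ v ⊗ₜ[ℂ] a := rfl

theorem derTensor_lie (δ : Derivation ℂ A A) (ξ ζ : A ⊗[ℂ] L) :
    derTensor δ ⁅ξ, ζ⁆ = ⁅derTensor δ ξ, ζ⁆ + ⁅ξ, derTensor δ ζ⁆ := by
  induction ξ using TensorProduct.induction_on with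
  | zero => simp
  | add ξ ξ' h h' => rw [add_lie, map_add, map_add, h, h', add_lie, add_lie]; abel
  | tmul u a =>
    induction ζ using TensorProduct.induction_on with
    | zero => simp
    | add ζ ζ' h h' => rw [lie_add, map_add, map_add, h, h', lie_add, lie_add]; abel
    | tmul v b =>
      simp only [LieAlgebra.ExtendScalars.bracket_tmul, derTensor_tmul, Derivation.leibniz,
        smul_eq_mul, ← TensorProduct.add_tmul]
      congr 1
      ring

/-- Moving `η` through `(ad N)^l` is a binomial expansion that stops after its first correction
because `[N, [N, η]] = 0`. For `l = 0` the truncated exponent `l - 1` is harmless, its coefficient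
being `0`. -/
theorem ad_pow_lie (η : A ⊗[ℂ] L) (h : ⁅N, ⁅N, η⁆⁆ = 0) (l : ℕ) (ξ : A ⊗[ℂ] L) :
    ⁅η, (LieAlgebra.ad A (A ⊗[ℂ] L) N ^ l) ξ⁆ = (LieAlgebra.ad A (A ⊗[ℂ] L) N ^ l) ⁅η, ξ⁆ -
      l • (LieAlgebra.ad A (A ⊗[ℂ] L) N ^ (l - 1)) ⁅⁅N, η⁆, ξ⁆ := by
  induction l generalizing ξ with
  | zero => simp
  | succ l ih =>
    have h2 : ⁅⁅N, η⁆, ⁅N, ξ⁆⁆ = ⁅N, ⁅⁅N, η⁆, ξ⁆⁆ := by rw [leibniz_lie N, h, zero_lie, zero_add]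
    rw [pow_succ, Module.End.mul_apply, Module.End.mul_apply, LieAlgebra.ad_apply, ih,
      LieAlgebra.ad_apply, leibniz_lie N η ξ, map_add, h2, add_tsub_cancel_right]
    rcases l with _ | l
    · simp
    · simp only [add_tsub_cancel_right, pow_succ, Module.End.mul_apply, LieAlgebra.ad_apply]
      module

/-- The product rule puts `∂N` in each of the `l` positions; moving it to the innermost one costs `0
+ 1 + ⋯ + (l - 1)` commutators `[N, ∂N]`. -/
theorem derTensor_ad_pow (δ : Derivation ℂ A A) (h : ⁅N, ⁅N, derTensor δ N⁆⁆ = 0) (l : ℕ) (a : L) :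
    derTensor δ ((LieAlgebra.ad A (A ⊗[ℂ] L) N ^ l) (1 ⊗ₜ a)) =
      (l : ℂ) • (LieAlgebra.ad A (A ⊗[ℂ] L) N ^ (l - 1)) ⁅derTensor δ N, 1 ⊗ₜ a⁆ -
      (l * (l - 1) / 2 : ℂ) •
        (LieAlgebra.ad A (A ⊗[ℂ] L) N ^ (l - 2)) ⁅⁅N, derTensor δ N⁆, 1 ⊗ₜ a⁆ := by
  have hA : ∀ (k : ℕ) (ζ : A ⊗[ℂ] L), ⁅N, (LieAlgebra.ad A (A ⊗[ℂ] L) N ^ k) ζ⁆ =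
      (LieAlgebra.ad A (A ⊗[ℂ] L) N ^ (k + 1)) ζ := fun k ζ => by rw [pow_succ']; rfl
  induction l with
  | zero => simp [derTensor_tmul]
  | succ l ih =>
    rw [pow_succ', Module.End.mul_apply, LieAlgebra.ad_apply, derTensor_lie, ih, ad_pow_lie _ h,
      lie_sub, lie_smul, lie_smul, hA, hA, add_tsub_cancel_right]
    rcases l with _ | _ | l
    · simp
    · norm_num
      module
    · simp only [show l + 1 + 1 - 1 = l + 1 from rfl,
        show l + 1 + 1 - 2 = l from rfl, show l + 1 + 1 + 1 - 2 = l + 1 from rfl]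
      push_cast
      module

variable {M : Type*} [AddCommGroup M] [Module A M] [Module ℂ M] [IsScalarTower ℂ A M]

/-- The derivation `δ` applied to the coefficients of a linear function on `A ⊗ L`. -/
def derCoeff (δ : Derivation ℂ A M) (c : A ⊗[ℂ] L →ₗ[A] A) : A ⊗[ℂ] L →ₗ[A] M :=
  LinearMap.liftBaseChange A
    ((δ : A →ₗ[ℂ] M) ∘ₗ c.restrictScalars ℂ ∘ₗ TensorProduct.mk ℂ A L 1)

theorem derCoeff_tmul (δ : Derivation ℂ A M) (c : A ⊗[ℂ] L →ₗ[A] A) (v : A) (a : L) :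
    derCoeff δ c (v ⊗ₜ a) = v • δ (c (1 ⊗ₜ a)) := by
  simp [derCoeff]

variable {τ : Type*} [Fintype τ] {y : τ → A} {z : τ → L} {t₀ : τ}

theorem derCoeff_comp_ad (hN : N = ∑ t, y t ⊗ₜ z t) (δ : Derivation ℂ A M)
    (hδ : ∀ t ≠ t₀, δ (y t) = 0) (c : A ⊗[ℂ] L →ₗ[A] A) (ξ : A ⊗[ℂ] L) :
    derCoeff δ (c ∘ₗ LieAlgebra.ad A (A ⊗[ℂ] L) N) ξ =
      derCoeff δ c ⁅N, ξ⁆ + c ⁅(1 : A) ⊗ₜ[ℂ] z t₀, ξ⁆ • δ (y t₀) := by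
  classical
  induction ξ using TensorProduct.induction_on with
  | zero => simp
  | add ξ ξ' h h' => rw [map_add, h, h', lie_add, lie_add, map_add, map_add, add_smul]; abel
  | tmul u a =>
    have h1 : ∀ v : A, ∀ b : L, c (v ⊗ₜ b) = v * c (1 ⊗ₜ b) := fun v b => by
      rw [← smul_eq_mul, ← map_smul, TensorProduct.smul_tmul', smul_eq_mul, mul_one]
    have h2 : ∀ t, δ (y t * c (1 ⊗ₜ ⁅z t, a⁆)) =
        y t • δ (c (1 ⊗ₜ ⁅z t, a⁆)) +
          (if t = t₀ then c (1 ⊗ₜ ⁅z t₀, a⁆) • δ (y t₀) else 0) := fun t => by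
      rw [Derivation.leibniz]
      split_ifs with h
      · rw [h]
      · rw [hδ t h, smul_zero]
    rw [derCoeff_tmul, LinearMap.comp_apply, LieAlgebra.ad_apply, hN, sum_lie, map_sum, map_sum,
      sum_lie, map_sum]
    simp only [LieAlgebra.ExtendScalars.bracket_tmul, mul_one, one_mul, derCoeff_tmul]
    rw [Finset.sum_congr rfl fun t _ => by rw [h1, h2 t], Finset.sum_add_distrib, smul_add,
      Finset.sum_ite_eq' Finset.univ t₀, if_pos (Finset.mem_univ _), h1 u, mul_smul,
      Finset.smul_sum]
    simp only [← mul_smul, mul_comm u]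

/-- Only the coefficient `y t₀` is seen by `δ`, and `z t₀` commutes with `N`, so each of the `l`
factors contributes the same term. The functional `c` varies in the induction, because peeling off
an outer `ad N` replaces it by `c ∘ ad N`. -/
theorem derivation_ad_pow (hN : N = ∑ t, y t ⊗ₜ z t) (δ : Derivation ℂ A M)
    (hδ : ∀ t ≠ t₀, δ (y t) = 0) (hz : ⁅N, (1 : A) ⊗ₜ[ℂ] z t₀⁆ = 0) (l : ℕ)
    (c : A ⊗[ℂ] L →ₗ[A] A) (a : L) :
    δ (c ((LieAlgebra.ad A (A ⊗[ℂ] L) N ^ l) (1 ⊗ₜ a))) =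
      derCoeff δ c ((LieAlgebra.ad A (A ⊗[ℂ] L) N ^ l) (1 ⊗ₜ a)) +
      (l : ℂ) • c ((LieAlgebra.ad A (A ⊗[ℂ] L) N ^ (l - 1)) (1 ⊗ₜ ⁅z t₀, a⁆)) • δ (y t₀) := by
  induction l generalizing c with
  | zero => simp [derCoeff_tmul]
  | succ l ih =>
    have h1 := ih (c ∘ₗ LieAlgebra.ad A (A ⊗[ℂ] L) N)
    have hz' : ⁅N, ⁅N, (1 : A) ⊗ₜ[ℂ] z t₀⁆⁆ = 0 := by rw [hz, lie_zero]
    have h2 := ad_pow_lie ((1 : A) ⊗ₜ[ℂ] z t₀) hz' l (1 ⊗ₜ a)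
    rw [hz, zero_lie, map_zero, smul_zero, sub_zero, LieAlgebra.ExtendScalars.bracket_tmul,
      one_mul] at h2
    rw [derCoeff_comp_ad hN δ hδ, h2, LinearMap.comp_apply, LinearMap.comp_apply,
      ← LieAlgebra.ad_apply A, ← Module.End.mul_apply, ← pow_succ', add_assoc] at h1
    rw [h1, add_tsub_cancel_right]
    congr 1
    rcases l with _ | l
    · simp
    · rw [add_tsub_cancel_right, ← Module.End.mul_apply, ← pow_succ', Nat.cast_succ (l + 1),
        add_smul, one_smul, add_comm]

variable [Module ℚ A]

/-- The operator `exp (ad N)` of `A ⊗ L`. -/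
def expAd (N : A ⊗[ℂ] L) : Module.End A (A ⊗[ℂ] L) :=
  IsNilpotent.exp (LieAlgebra.ad A (A ⊗[ℂ] L) N)

theorem expAd_lie (hN : IsNilpotent (LieAlgebra.ad A (A ⊗[ℂ] L) N)) (ξ ζ : A ⊗[ℂ] L) :
    expAd N ⁅ξ, ζ⁆ = ⁅expAd N ξ, expAd N ζ⁆ :=
  bilinear_exp (LinearMap.mk₂ A (fun a b : A ⊗[ℂ] L => ⁅a, b⁆) add_lie smul_lie lie_add
    fun c a b => lie_smul c a b) hN hN (fun a b => by simp) ξ ζ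

theorem baseChange_expAd (hN : IsNilpotent (LieAlgebra.ad A (A ⊗[ℂ] L) N))
    (B : LinearMap.BilinForm ℂ L) (hB : ∀ a b c, B ⁅a, b⁆ c = B a ⁅b, c⁆) (ξ ζ : A ⊗[ℂ] L) :
    B.baseChange A (expAd N ξ) (expAd N ζ) = B.baseChange A ξ ζ := by
  rw [expAd, ← bilinear_exp (B.baseChange A) hN (T := 0) IsNilpotent.zero fun a b => ?_]
  · rw [IsNilpotent.exp_zero]
    rfl
  · rw [LieAlgebra.ad_apply, LieAlgebra.ad_apply, ← baseChange_lie B hB, ← lie_skew a N, map_neg,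
      LinearMap.neg_apply, add_neg_cancel]
    rfl

theorem expAd_eq_sum {k : ℕ} (hN : LieAlgebra.ad A (A ⊗[ℂ] L) N ^ k = 0) (ξ : A ⊗[ℂ] L) :
    expAd N ξ =
      ∑ l ∈ Finset.range k, (l.factorial : ℂ)⁻¹ • (LieAlgebra.ad A (A ⊗[ℂ] L) N ^ l) ξ := by
  rw [expAd, IsNilpotent.exp_eq_sum hN, LinearMap.sum_apply]
  refine Finset.sum_congr rfl fun l _ => ?_
  rw [LinearMap.smul_apply, ← Rat.cast_smul_eq_qsmul ℂ]
  push_cast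
  rfl

theorem expAd_eq_self (hN : IsNilpotent (LieAlgebra.ad A (A ⊗[ℂ] L) N)) {ζ : A ⊗[ℂ] L}
    (h : ⁅N, ζ⁆ = 0) : expAd N ζ = ζ := by
  obtain ⟨k, hk⟩ := hN
  rw [expAd_eq_sum (k := k + 1) (by rw [pow_succ, hk, zero_mul]), Finset.sum_range_succ',
    Finset.sum_eq_zero]
  · simp
  · intro l _
    rw [pow_succ, Module.End.mul_apply, LieAlgebra.ad_apply, h, map_zero, smul_zero]

/-- The series for the logarithmic derivative of `exp` breaks off after `½[N, ∂N]`, as higher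
commutators vanish. -/
theorem derTensor_expAd (hN : LieAlgebra.ad A (A ⊗[ℂ] L) N ^ 5 = 0) (δ : Derivation ℂ A A)
    (h : ⁅N, ⁅N, derTensor δ N⁆⁆ = 0) (a : L) :
    derTensor δ (expAd N (1 ⊗ₜ a)) =
      expAd N ⁅derTensor δ N - (1 / 2 : ℂ) • ⁅N, derTensor δ N⁆, 1 ⊗ₜ a⁆ := by
  -- Two extra (zero) terms on the left match the index shifts by one and two in `derTensor_ad_pow`.
  rw [expAd_eq_sum (k := 7) (by rw [pow_add _ 5 2, hN, zero_mul]), expAd_eq_sum hN, map_sum]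
  simp only [map_smul, derTensor_ad_pow δ h, Finset.sum_range_succ, Finset.sum_range_zero, sub_lie,
    smul_lie, map_sub, LinearMap.map_smul_of_tower]
  norm_num [hN, Nat.factorial]
  module

/-- Since `l / l! = 1 / (l - 1)!`, the terms of `derivation_ad_pow` add up to an exponential again.
-/
theorem derivation_expAd (hN : N = ∑ t, y t ⊗ₜ z t)
    (hN5 : LieAlgebra.ad A (A ⊗[ℂ] L) N ^ 5 = 0) (δ : Derivation ℂ A M)
    (hδ : ∀ t ≠ t₀, δ (y t) = 0) (hz : ⁅N, (1 : A) ⊗ₜ[ℂ] z t₀⁆ = 0)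
    (c : A ⊗[ℂ] L →ₗ[A] A) (a : L) :
    δ (c (expAd N (1 ⊗ₜ a))) =
      derCoeff δ c (expAd N (1 ⊗ₜ a)) + c (expAd N (1 ⊗ₜ ⁅z t₀, a⁆)) • δ (y t₀) := by
  rw [expAd_eq_sum (k := 6) (by rw [pow_add _ 5 1, hN5, zero_mul]), expAd_eq_sum hN5]
  simp only [map_sum, LinearMap.map_smul_of_tower, Derivation.map_smul,
    derivation_ad_pow hN δ hδ hz, Finset.sum_add_distrib, smul_add]
  congr 1
  rw [Finset.sum_range_succ', Finset.sum_smul, Nat.cast_zero, zero_smul, smul_zero, add_zero]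
  refine Finset.sum_congr rfl fun l _ => ?_
  rw [smul_smul, smul_assoc, add_tsub_cancel_right, Nat.factorial_succ]
  congr 1
  have : (l.factorial : ℂ) ≠ 0 := by exact_mod_cast l.factorial_ne_zero
  have : (l + 1 : ℂ) ≠ 0 := by exact_mod_cast l.succ_ne_zero
  push_cast
  field_simp

end Exp

end FracW

end

/-! ### The gauge element and `η̃_m` as an exponential -/

noncomputable section

namespace FracW

open scoped TensorProduct

namespace MinimalDatum

variable {𝔤 : Type*} [LieRing 𝔤] [LieAlgebra ℂ 𝔤] (D : MinimalDatum 𝔤)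

theorem zStarExt_mem (t : Fin (2 * D.s) ⊕ Unit) :
    ∃ r : ℚ, 1 / 2 ≤ r ∧ D.zStarExt t ∈ gradedPiece D.h r := by
  rcases t with i | _
  · exact ⟨1 / 2, le_rfl, (D.zStar i).2⟩
  · exact ⟨1, by norm_num, D.e_mem⟩

theorem nest_cons (a : 𝔤) {l : ℕ} (t : Fin (2 * D.s) ⊕ Unit) (I : Fin l → Fin (2 * D.s) ⊕ Unit) :
    D.nest a (Fin.cons t I : Fin (l + 1) → _) = D.nest ⁅a, D.zStarExt t⁆ I := by
  simp [nest, List.ofFn_succ]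

theorem zStar_eq_sum (i : Fin (2 * D.s)) :
    (D.zStar i : 𝔤) = ∑ q, D.z.repr (D.zStar i) q • (D.z q : 𝔤) := by
  conv_lhs => rw [← D.z.sum_repr (D.zStar i)]
  simp only [Submodule.coe_sum, Submodule.coe_smul]

/-- Expanding `z_i^*` in the basis `z` identifies its coordinates with structure constants. This
turns the double sum in `[N, ∂N]` into the single sum in `η_m(f)`. -/
theorem lie_zStar_zStar (i r : Fin (2 * D.s)) :
    ⁅(D.zStar i : 𝔤), (D.zStar r : 𝔤)⁆ = D.z.repr (D.zStar i) r • D.e := by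
  conv_lhs => rw [zStar_eq_sum]
  rw [sum_lie]
  simp [smul_lie, D.lie_z_zStar]

section FiniteDimensional

variable [FiniteDimensional ℂ 𝔤]

theorem lie_e_zStarExt (t : Fin (2 * D.s) ⊕ Unit) : ⁅D.e, D.zStarExt t⁆ = 0 := by
  obtain ⟨r, hr, ht⟩ := D.zStarExt_mem t
  exact D.eq_zero_of_one_lt (by linarith) (lie_mem_gradedPiece D.e_mem ht)

theorem lie_zStarExt_lie (q t r : Fin (2 * D.s) ⊕ Unit) :
    ⁅D.zStarExt q, ⁅D.zStarExt t, D.zStarExt r⁆⁆ = 0 := by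
  obtain ⟨_, h1, hq⟩ := D.zStarExt_mem q
  obtain ⟨_, h2, ht⟩ := D.zStarExt_mem t
  obtain ⟨_, h3, hr⟩ := D.zStarExt_mem r
  exact D.eq_zero_of_one_lt (by linarith) (lie_mem_gradedPiece hq (lie_mem_gradedPiece ht hr))

end FiniteDimensional

/-! The elements `a z^j` are now replaced by the values `cu j a` of arbitrary linear maps `cu j`
into a commutative algebra `A`. -/

variable {A : Type*} [CommRing A] [Algebra ℂ A]

/-- The part of `A ⊗ 𝔤` of degree at least `r`. -/
def filt (A : Type*) [CommRing A] [Algebra ℂ A] (r : ℚ) : Submodule A (A ⊗[ℂ] 𝔤) :=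
  Submodule.span A {ξ | ∃ i, r ≤ D.wt i ∧ ξ = 1 ⊗ₜ D.u i}

theorem one_tmul_mem_filt {a : 𝔤} {r s : ℚ} (ha : a ∈ gradedPiece D.h s) (hr : r ≤ s) :
    (1 : A) ⊗ₜ[ℂ] a ∈ D.filt A r := by
  rw [← D.u.sum_repr a, TensorProduct.tmul_sum]
  refine Submodule.sum_mem _ fun i _ => ?_
  by_cases h : D.wt i = s
  · rw [TensorProduct.tmul_smul]
    exact Submodule.smul_of_tower_mem _ _ (Submodule.subset_span ⟨i, by rw [h]; exact hr, rfl⟩)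
  · rw [D.repr_eq_zero ha h, zero_smul, TensorProduct.tmul_zero]
    exact Submodule.zero_mem _

variable (cu : ℕ → 𝔤 →ₗ[ℂ] A) (m : ℕ)

/-- The element `-∑ (z_i z^m) ⊗ z_i^*` of `A ⊗ 𝔤`, whose exponential defines `η̃_m`. -/
def gauge : A ⊗[ℂ] 𝔤 := ∑ t, (-cu m (D.zExt t)) ⊗ₜ[ℂ] D.zStarExt t

/-- The minus sign in `gauge` turns the left brackets of `ad N` into the right-nested brackets of
`η̃_m`. -/
theorem ad_gauge_pow (l j : ℕ) (v : A) (a : 𝔤) :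
    (cu j).liftBaseChange A ((LieAlgebra.ad A (A ⊗[ℂ] 𝔤) (D.gauge cu m) ^ l) (v ⊗ₜ a)) =
      v * ∑ I : Fin l → Fin (2 * D.s) ⊕ Unit,
        (∏ t, cu m (D.zExt (I t))) * cu j (D.nest a I) := by
  induction l generalizing v a with
  | zero => simp [nest]
  | succ l ih =>
    have h1 : ⁅D.gauge cu m, v ⊗ₜ[ℂ] a⁆ =
        ∑ t, (v * cu m (D.zExt t)) ⊗ₜ[ℂ] ⁅a, D.zStarExt t⁆ := by
      rw [gauge, sum_lie]
      refine Finset.sum_congr rfl fun t _ => ?_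
      rw [LieAlgebra.ExtendScalars.bracket_tmul, ← lie_skew a, TensorProduct.tmul_neg, neg_mul,
        TensorProduct.neg_tmul, mul_comm v]
    rw [pow_succ, Module.End.mul_apply, LieAlgebra.ad_apply, h1, map_sum, map_sum,
      ← (Fin.consEquiv fun _ => Fin (2 * D.s) ⊕ Unit).sum_comp, Fintype.sum_prod_type,
      Finset.mul_sum]
    refine Finset.sum_congr rfl fun t _ => ?_
    rw [ih, mul_assoc, Finset.mul_sum]
    congr 1
    refine Finset.sum_congr rfl fun I _ => ?_
    change _ = (∏ s, cu m (D.zExt ((Fin.cons t I : Fin (l + 1) → Fin (2 * D.s) ⊕ Unit) s))) *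
      cu j (D.nest a (Fin.cons t I))
    rw [Fin.prod_univ_succ, nest_cons]
    simp only [Fin.cons_zero, Fin.cons_succ, mul_assoc]

theorem lie_gauge_mem_filt {ξ : A ⊗[ℂ] 𝔤} {r : ℚ} (hξ : ξ ∈ D.filt A r) :
    ⁅D.gauge cu m, ξ⁆ ∈ D.filt A (r + 1 / 2) := by
  induction hξ using Submodule.span_induction with
  | zero => rw [lie_zero]; exact Submodule.zero_mem _
  | add ξ ζ _ _ h h' => rw [lie_add]; exact Submodule.add_mem _ h h'
  | smul v ξ _ h => rw [lie_smul]; exact Submodule.smul_mem _ _ h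
  | mem ξ h =>
    obtain ⟨i, hi, rfl⟩ := h
    rw [gauge, sum_lie]
    refine Submodule.sum_mem _ fun t _ => ?_
    obtain ⟨s, hs, ht⟩ := D.zStarExt_mem t
    rw [LieAlgebra.ExtendScalars.bracket_tmul, ← smul_eq_mul, ← TensorProduct.smul_tmul']
    exact Submodule.smul_mem _ _
      (D.one_tmul_mem_filt (lie_mem_gradedPiece ht (D.u_mem i)) (by linarith))

theorem derTensor_gauge (δ : Derivation ℂ A A) :
    derTensor δ (D.gauge cu m) = ∑ t, (-δ (cu m (D.zExt t))) ⊗ₜ[ℂ] D.zStarExt t := by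
  rw [gauge, map_sum]
  simp only [derTensor_tmul, map_neg]

theorem lie_gauge_derTensor_gauge (δ : Derivation ℂ A A) :
    ⁅D.gauge cu m, derTensor δ (D.gauge cu m)⁆ =
      ∑ t, ∑ r, (cu m (D.zExt t) * δ (cu m (D.zExt r))) ⊗ₜ[ℂ]
        ⁅D.zStarExt t, D.zStarExt r⁆ := by
  rw [derTensor_gauge, gauge, sum_lie_sum]
  refine Finset.sum_congr rfl fun t _ => Finset.sum_congr rfl fun r _ => ?_
  rw [LieAlgebra.ExtendScalars.bracket_tmul, neg_mul_neg]

/-- The left logarithmic derivative of the gauge transformation. -/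
def logDer (δ : Derivation ℂ A A) : A ⊗[ℂ] 𝔤 :=
  derTensor δ (D.gauge cu m) - (1 / 2 : ℂ) • ⁅D.gauge cu m, derTensor δ (D.gauge cu m)⁆

/-- The terms of `η_m(a)` that contain derivatives, divided by `-k`. -/
def etaDel (δ : Derivation ℂ A A) (a : 𝔤) : A :=
  (∑ i, D.form (D.zStar i) a • δ (cu m (D.z i))) +
    D.form D.e a • (δ (cu m D.x) +
      (1 / 2 : ℂ) • ∑ i, δ (cu m (D.zStar i)) * cu m (D.z i))

/-- `η̃_m(a z^j)` as the value of `exp (ad (gauge))`. -/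
def gaugeEta [Module ℚ A] (a : 𝔤) (j : ℕ) : A :=
  (cu j).liftBaseChange A (expAd (D.gauge cu m) (1 ⊗ₜ a))

section FiniteDimensional

variable [FiniteDimensional ℂ 𝔤]

theorem lie_gauge_e : ⁅D.gauge cu m, (1 : A) ⊗ₜ[ℂ] D.e⁆ = 0 := by
  rw [gauge, sum_lie]
  refine Finset.sum_eq_zero fun t _ => ?_
  rw [LieAlgebra.ExtendScalars.bracket_tmul, ← lie_skew, lie_e_zStarExt, neg_zero,
    TensorProduct.tmul_zero]

/-- A triple commutator of the `z_t^*` has weight at least `3/2`. -/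
theorem lie_gauge_lie_gauge (δ : Derivation ℂ A A) :
    ⁅D.gauge cu m, ⁅D.gauge cu m, derTensor δ (D.gauge cu m)⁆⁆ = 0 := by
  rw [lie_gauge_derTensor_gauge, gauge, sum_lie]
  refine Finset.sum_eq_zero fun q _ => ?_
  rw [lie_sum]
  refine Finset.sum_eq_zero fun t _ => ?_
  rw [lie_sum]
  refine Finset.sum_eq_zero fun r _ => ?_
  rw [LieAlgebra.ExtendScalars.bracket_tmul, lie_zStarExt_lie, TensorProduct.tmul_zero]

/-- This identity explains the derivative terms of `η_m`: they are the functional dual to the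
logarithmic derivative. The factor `½` in `η_m(f)` is the one in front of `[N, ∂N]`. -/
theorem baseChange_logDer (δ : Derivation ℂ A A) (a : 𝔤) :
    D.form.baseChange A (D.logDer cu m δ) (1 ⊗ₜ a) = -D.etaDel cu m δ a := by
  have hb : ∀ (v : A) (b : 𝔤), D.form.baseChange A (v ⊗ₜ[ℂ] b) (1 ⊗ₜ[ℂ] a) =
      D.form b a • v := fun v b => by
    rw [LinearMap.BilinForm.baseChange_tmul, mul_one]
  have h1 : D.form.baseChange A (derTensor δ (D.gauge cu m)) (1 ⊗ₜ a) =
      -((∑ i, D.form (D.zStar i) a • δ (cu m (D.z i))) + D.form D.e a • δ (cu m D.x)) := by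
    rw [derTensor_gauge, map_sum, LinearMap.sum_apply]
    simp only [hb, Fintype.sum_sum_type, zExt, zStarExt, Sum.elim_inl, Sum.elim_inr,
      Finset.univ_unique, Finset.sum_singleton, smul_neg, Finset.sum_neg_distrib, neg_add]
  have h2 : ∀ t r, D.form ⁅D.zStarExt t, D.zStarExt r⁆ a •
      (cu m (D.zExt t) * δ (cu m (D.zExt r))) =
      Sum.elim (fun i => Sum.elim (fun q => D.form D.e a •
        ((D.z.repr (D.zStar i) q • δ (cu m (D.z q))) *
          cu m (D.z i))) (fun _ => 0) r) (fun _ => 0) t := by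
    rintro (i | _) (q | _)
    · simp only [zExt, zStarExt, Sum.elim_inl, lie_zStar_zStar, map_smul, LinearMap.smul_apply,
        smul_eq_mul, smul_mul_assoc, smul_smul]
      rw [mul_comm (D.form D.e a), mul_comm (cu m _)]
    all_goals
      simp [zStarExt, ← lie_skew _ D.e, D.lie_e_half (D.zStar _).2]
  have h3 : D.form.baseChange A ⁅D.gauge cu m, derTensor δ (D.gauge cu m)⁆ (1 ⊗ₜ a) =
      D.form D.e a • ∑ i, δ (cu m (D.zStar i)) * cu m (D.z i) := by
    rw [lie_gauge_derTensor_gauge, map_sum, LinearMap.sum_apply]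
    simp only [map_sum, LinearMap.sum_apply, hb, h2]
    simp only [Fintype.sum_sum_type, Sum.elim_inl, Sum.elim_inr, Finset.sum_const_zero, add_zero,
      Finset.smul_sum]
    refine Finset.sum_congr rfl fun i _ => ?_
    rw [zStar_eq_sum, map_sum, map_sum, Finset.sum_mul, Finset.smul_sum]
    simp only [map_smul, Derivation.map_smul]
  rw [logDer, map_sub, LinearMap.sub_apply, h1, LinearMap.map_smul_of_tower, LinearMap.smul_apply,
    h3, etaDel]
  module

variable [LieAlgebra.IsSimple ℂ 𝔤]

theorem ad_gauge_pow_five : LieAlgebra.ad A (A ⊗[ℂ] 𝔤) (D.gauge cu m) ^ 5 = 0 := by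
  have h0 : ∀ ξ, ξ ∈ D.filt A (-1) := fun ξ => by
    induction ξ using TensorProduct.induction_on with
    | zero => exact Submodule.zero_mem _
    | add ξ ζ h h' => exact Submodule.add_mem _ h h'
    | tmul v a =>
      rw [← D.u.sum_repr a, TensorProduct.tmul_sum]
      refine Submodule.sum_mem _ fun i _ => ?_
      rw [TensorProduct.tmul_smul, ← mul_one v, ← smul_eq_mul, ← TensorProduct.smul_tmul']
      exact Submodule.smul_of_tower_mem _ _ (Submodule.smul_mem _ _
        (Submodule.subset_span ⟨i, D.neg_one_le_wt i, rfl⟩))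
  have h1 : ∀ l : ℕ, ∀ ξ, (LieAlgebra.ad A (A ⊗[ℂ] 𝔤) (D.gauge cu m) ^ l) ξ ∈
      D.filt A (-1 + l / 2) := fun l ξ => by
    induction l with
    | zero => simpa using h0 ξ
    | succ l ih =>
      rw [pow_succ', Module.End.mul_apply, LieAlgebra.ad_apply]
      convert D.lie_gauge_mem_filt cu m ih using 2
      push_cast
      ring
  -- Starting at weight `-1`, five steps of `1/2` reach `3/2`, above the largest weight `1`.
  have h2 : D.filt A (-1 + (5 : ℕ) / 2) = ⊥ := by
    refine (Submodule.span_eq_bot).2 ?_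
    rintro _ ⟨i, hi, rfl⟩
    have := D.wt_le_one i
    norm_num at hi
    linarith
  refine LinearMap.ext fun ξ => ?_
  have := h1 5 ξ
  rw [h2] at this
  exact (Submodule.mem_bot _).1 this

theorem isNilpotent_ad_gauge : IsNilpotent (LieAlgebra.ad A (A ⊗[ℂ] 𝔤) (D.gauge cu m)) :=
  ⟨5, D.ad_gauge_pow_five cu m⟩

variable [Module ℚ A]

theorem gaugeEta_eq_sum (a : 𝔤) (j : ℕ) :
    D.gaugeEta cu m a j =
      ∑ l ∈ Finset.range 5, ∑ I : Fin l → Fin (2 * D.s) ⊕ Unit,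
        (1 / (l.factorial : ℂ)) • ((∏ t, cu m (D.zExt (I t))) * cu j (D.nest a I)) := by
  rw [gaugeEta, expAd_eq_sum (D.ad_gauge_pow_five cu m), map_sum]
  refine Finset.sum_congr rfl fun l _ => ?_
  rw [LinearMap.map_smul_of_tower, ad_gauge_pow, one_mul, Finset.smul_sum, one_div]

/-- A derivation that annihilates `𝔤(1/2) z^m`, applied to `η̃_m(a z^j)`. -/
theorem derivation_gaugeEta {M : Type*} [AddCommGroup M] [Module A M] [Module ℂ M]
    [IsScalarTower ℂ A M] (δ : Derivation ℂ A M)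
    (hδ : ∀ w ∈ gradedPiece D.h (1 / 2), δ (cu m w) = 0) (a : 𝔤) (j : ℕ) :
    δ (D.gaugeEta cu m a j) =
      LinearMap.liftBaseChange A ((δ : A →ₗ[ℂ] M) ∘ₗ cu j)
        (expAd (D.gauge cu m) (1 ⊗ₜ a)) +
      D.gaugeEta cu m ⁅a, D.e⁆ j • δ (cu m D.x) := by
  rw [gaugeEta, derivation_expAd (N := D.gauge cu m) (t₀ := Sum.inr ())
    (y := fun t => -cu m (D.zExt t)) (z := D.zStarExt) rfl (D.ad_gauge_pow_five cu m)]
  · congr 1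
    · congr 1
      refine TensorProduct.AlgebraTensorModule.curry_injective ?_
      refine LinearMap.ext_ring ?_
      refine LinearMap.ext fun b => ?_
      simp [derCoeff_tmul]
    · rw [gaugeEta, ← lie_skew, TensorProduct.tmul_neg, map_neg, map_neg, map_neg, neg_smul,
        smul_neg, neg_neg]
      rfl
  · rintro (i | _) ht
    · rw [map_neg, neg_eq_zero]
      exact hδ _ (D.z i).2
    · exact absurd rfl ht
  · exact D.lie_gauge_e cu m

theorem derTensor_expAd_gauge (δ : Derivation ℂ A A) (a : 𝔤) :
    derTensor δ (expAd (D.gauge cu m) (1 ⊗ₜ a)) =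
      expAd (D.gauge cu m) ⁅D.logDer cu m δ, (1 : A) ⊗ₜ[ℂ] a⁆ :=
  derTensor_expAd (D.ad_gauge_pow_five cu m) _ (D.lie_gauge_lie_gauge cu m _) a

end FiniteDimensional

end MinimalDatum

end FracW

end

/-! ### Abstract `λ`-brackets of gauged generators -/

noncomputable section

namespace FracW

open scoped TensorProduct Polynomial

/-- A `λ`-bracket on a differential algebra `(A, δ)`, seen as a function `br` of the differential
of its first argument. The operator `lam` is `λ + δ`. -/
structure LambdaBracket (A Ω : Type*) [CommRing A] [Algebra ℂ A] [AddCommGroup Ω] [Module A Ω]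
    [Module ℂ Ω] [IsScalarTower ℂ A Ω] (δ : Derivation ℂ A A) where
  lam : Module.End ℂ A[X]
  lam_C : ∀ v, lam (Polynomial.C v) = Polynomial.X * Polynomial.C v + Polynomial.C (δ v)
  diff : Derivation ℂ A Ω
  diffDel : Ω →ₗ[ℂ] Ω
  diff_del : ∀ v, diff (δ v) = diffDel (diff v)
  diffDel_smul : ∀ (v : A) (ω : Ω), diffDel (v • ω) = v • diffDel ω + δ v • ω
  br : Ω →ₗ[ℂ] Derivation ℂ A A[X]
  br_del : ∀ ω v, br ω (δ v) = lam (br ω v)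
  br_diffDel : ∀ ω v, br (diffDel ω) v = -(Polynomial.X * br ω v)

namespace LambdaBracket

variable {A Ω : Type*} [CommRing A] [Algebra ℂ A] [AddCommGroup Ω] [Module A Ω]
    [Module ℂ Ω] [IsScalarTower ℂ A Ω] {δ : Derivation ℂ A A} (B : LambdaBracket A Ω δ)

theorem br_smul_diff_del (u v G : A) :
    B.br (u • B.diff (δ v)) G =
      -(Polynomial.X * B.br (u • B.diff v) G) - B.br (δ u • B.diff v) G := by
  have : u • B.diff (δ v) = B.diffDel (u • B.diff v) - δ u • B.diff v := by
    rw [B.diffDel_smul, B.diff_del, add_sub_cancel_right]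
  rw [this, map_sub, Derivation.sub_apply, B.br_diffDel]

variable {𝔤 : Type*} [LieRing 𝔤] [LieAlgebra ℂ 𝔤]

/-- The `λ`-bracket of `v (a z^i)` and `w (b z^j)`, without the terms that involve brackets with
the coefficients `v`, `w`, as a function of `v ⊗ a` and `w ⊗ b`. -/
def linBr (κ κ' : 𝔤 →ₗ[ℂ] A) (ξ : A ⊗[ℂ] 𝔤) : A ⊗[ℂ] 𝔤 →ₗ[A] A[X] :=
  ((B.br (((B.diff : A →ₗ[ℂ] Ω) ∘ₗ κ).liftBaseChange A ξ) : A →ₗ[ℂ] A[X]) ∘ₗ κ').liftBaseChange A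

theorem linBr_add (κ κ' : 𝔤 →ₗ[ℂ] A) (ξ ξ' ζ : A ⊗[ℂ] 𝔤) :
    B.linBr κ κ' (ξ + ξ') ζ = B.linBr κ κ' ξ ζ + B.linBr κ κ' ξ' ζ := by
  induction ζ using TensorProduct.induction_on with
  | zero => simp
  | add ζ ζ' h h' => rw [map_add, h, h', map_add, map_add]; abel
  | tmul w b =>
    simp [linBr]

theorem linBr_tmul (κ κ' : 𝔤 →ₗ[ℂ] A) (v w : A) (a b : 𝔤) :
    B.linBr κ κ' (v ⊗ₜ a) (w ⊗ₜ b) = w • B.br (v • B.diff (κ a)) (κ' b) := by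
  simp [linBr]

theorem linBr_zero (κ κ' : 𝔤 →ₗ[ℂ] A) (ζ : A ⊗[ℂ] 𝔤) : B.linBr κ κ' 0 ζ = 0 := by
  induction ζ using TensorProduct.induction_on with
  | zero => simp
  | add ζ ζ' h h' => rw [map_add, h, h', add_zero]
  | tmul w b => simp [linBr]

/-- Two biadditive maps that agree on pure tensors are equal. -/
theorem linBr_eq (κ κ' : 𝔤 →ₗ[ℂ] A) (T : A ⊗[ℂ] 𝔤 →+ A ⊗[ℂ] 𝔤 →+ A[X])
    (hT : ∀ (v w : A) (a b : 𝔤), w • B.br (v • B.diff (κ a)) (κ' b) = T (v ⊗ₜ a) (w ⊗ₜ b))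
    (ξ ζ : A ⊗[ℂ] 𝔤) : B.linBr κ κ' ξ ζ = T ξ ζ := by
  induction ξ using TensorProduct.induction_on with
  | zero => rw [linBr_zero, map_zero, AddMonoidHom.zero_apply]
  | add ξ ξ' h h' => rw [linBr_add, h, h', map_add, AddMonoidHom.add_apply]
  | tmul v a =>
    induction ζ using TensorProduct.induction_on with
    | zero => rw [map_zero, map_zero]
    | add ζ ζ' h h' => rw [map_add, h, h', map_add]
    | tmul w b => rw [linBr_tmul, hT]

theorem linBr_of_lie (κ κ' κ'' : 𝔤 →ₗ[ℂ] A)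
    (h : ∀ v a b, B.br (v • B.diff (κ a)) (κ' b) = -Polynomial.C (v * κ'' ⁅a, b⁆))
    (ξ ζ : A ⊗[ℂ] 𝔤) :
    B.linBr κ κ' ξ ζ = -Polynomial.C (κ''.liftBaseChange A ⁅ξ, ζ⁆) := by
  refine B.linBr_eq κ κ' (AddMonoidHom.mk' (fun ξ => AddMonoidHom.mk'
    (fun ζ => -Polynomial.C (κ''.liftBaseChange A ⁅ξ, ζ⁆)) fun ζ ζ' => ?_) fun ξ ξ' => ?_)
    (fun v w a b => ?_) ξ ζ
  · rw [lie_add, map_add, map_add, neg_add]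
  · ext1 ζ
    simp only [AddMonoidHom.mk'_apply, AddMonoidHom.add_apply, add_lie, map_add, neg_add]
  · simp only [AddMonoidHom.mk'_apply, LieAlgebra.ExtendScalars.bracket_tmul,
      LinearMap.liftBaseChange_tmul, h, Polynomial.smul_eq_C_mul, mul_neg, smul_eq_mul, map_mul]
    ring

/-- The cocycle term acts on the coefficient `v` by `λ + ∂`; its `∂` part is what later produces the
logarithmic derivative. -/
theorem linBr_of_lie_add_form (κ : 𝔤 →ₗ[ℂ] A) (f : LinearMap.BilinForm ℂ 𝔤) (k : ℂ)
    (h : ∀ v a b, B.br (v • B.diff (κ a)) (κ b) =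
      Polynomial.C (v * κ ⁅a, b⁆) + (k * f a b) • B.lam (Polynomial.C v)) (ξ ζ : A ⊗[ℂ] 𝔤) :
    B.linBr κ κ ξ ζ = Polynomial.C (κ.liftBaseChange A ⁅ξ, ζ⁆) +
      k • (Polynomial.X * Polynomial.C (f.baseChange A ξ ζ) +
        Polynomial.C (f.baseChange A (derTensor δ ξ) ζ)) := by
  refine B.linBr_eq κ κ (AddMonoidHom.mk' (fun ξ => AddMonoidHom.mk'
    (fun ζ => Polynomial.C (κ.liftBaseChange A ⁅ξ, ζ⁆) +
      k • (Polynomial.X * Polynomial.C (f.baseChange A ξ ζ) +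
        Polynomial.C (f.baseChange A (derTensor δ ξ) ζ))) fun ζ ζ' => ?_) fun ξ ξ' => ?_)
    (fun v w a b => ?_) ξ ζ
  · simp only [lie_add, map_add, mul_add, smul_add]
    abel
  · ext1 ζ
    simp only [AddMonoidHom.mk'_apply, AddMonoidHom.add_apply, add_lie, map_add, mul_add, smul_add,
      LinearMap.add_apply]
    abel
  · simp only [AddMonoidHom.mk'_apply, LieAlgebra.ExtendScalars.bracket_tmul, derTensor_tmul,
      LinearMap.BilinForm.baseChange_tmul, LinearMap.liftBaseChange_tmul, h, smul_eq_mul,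
      B.lam_C, smul_add, mul_smul, ← Polynomial.smul_C, mul_smul_comm]
    rw [smul_comm w k, smul_comm w k, smul_comm w (f a b), smul_comm w (f a b)]
    simp only [Polynomial.smul_eq_C_mul, map_mul]
    congr 1
    · ring
    · congr 2
      · congr 1
        ring
      · congr 1
        ring

end LambdaBracket

/-- A `λ`-bracket that satisfies the relations between the `a z^i` and `𝔤(1/2) z^m`, `x z^m` which
determine how `η̃_m` brackets. The level `r` is `0` for the first bracket, `1` for the second. -/
structure GaugedBracket {𝔤 : Type*} [LieRing 𝔤] [LieAlgebra ℂ 𝔤] (D : MinimalDatum 𝔤)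
    (A Ω : Type*) [CommRing A] [Algebra ℂ A] [AddCommGroup Ω] [Module A Ω]
    [Module ℂ Ω] [IsScalarTower ℂ A Ω] (δ : Derivation ℂ A A) (cu : ℕ → 𝔤 →ₗ[ℂ] A) (m r : ℕ)
    extends LambdaBracket A Ω δ where
  br_half_right : ∀ ω : Ω, ∀ w ∈ gradedPiece D.h (1 / 2), br ω (cu m w) = 0
  br_half_left : ∀ v : A, ∀ w ∈ gradedPiece D.h (1 / 2), br (v • diff (cu m w)) = 0
  br_x_right : ∀ (v : A) (i : ℕ) (a : 𝔤), br (v • diff (cu i a)) (cu m D.x) =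
    if i = r then Polynomial.C (D.form D.e a • v) else 0
  br_x_left : ∀ (v : A) (j : ℕ) (b : 𝔤), br (v • diff (cu m D.x)) (cu j b) =
    if j = r then -Polynomial.C (D.form D.e b • v) else 0

namespace GaugedBracket

variable {𝔤 : Type*} [LieRing 𝔤] [LieAlgebra ℂ 𝔤] {D : MinimalDatum 𝔤}
    {A Ω : Type*} [CommRing A] [Algebra ℂ A] [AddCommGroup Ω] [Module A Ω]
    [Module ℂ Ω] [IsScalarTower ℂ A Ω] {δ : Derivation ℂ A A} {cu : ℕ → 𝔤 →ₗ[ℂ] A} {m r : ℕ}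
    (B : GaugedBracket D A Ω δ cu m r)

/-- The span of the differentials of `w z^m` and `∂(w z^m)`, for `w ∈ 𝔤(1/2)`. -/
def halfSpan : Submodule A Ω :=
  Submodule.span A {ω | ∃ w ∈ gradedPiece D.h (1 / 2),
    ω = B.diff (cu m w) ∨ ω = B.diff (δ (cu m w))}

theorem diff_mem_halfSpan {w : 𝔤} (hw : w ∈ gradedPiece D.h (1 / 2)) :
    B.diff (cu m w) ∈ B.halfSpan := Submodule.subset_span ⟨w, hw, Or.inl rfl⟩

theorem diff_del_mem_halfSpan {w : 𝔤} (hw : w ∈ gradedPiece D.h (1 / 2)) :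
    B.diff (δ (cu m w)) ∈ B.halfSpan := Submodule.subset_span ⟨w, hw, Or.inr rfl⟩

/-- Left brackets may therefore be computed modulo `halfSpan`. All multiples `v • ω` are carried
through the induction because `br` is not `A`-linear. -/
theorem br_eq_zero_of_mem {ω : Ω} (hω : ω ∈ B.halfSpan) : B.br ω = 0 := by
  suffices ∀ v : A, B.br (v • ω) = 0 by simpa using this 1
  induction hω using Submodule.span_induction with
  | zero => simp
  | add ω ω' _ _ h h' => intro v; rw [smul_add, map_add, h, h', add_zero]
  | smul u ω _ h => intro v; rw [← mul_smul, h]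
  | mem ω h =>
    obtain ⟨w, hw, rfl | rfl⟩ := h
    · exact fun v => B.br_half_left v w hw
    · intro v
      ext1 G
      rw [B.br_smul_diff_del, B.br_half_left _ w hw, B.br_half_left _ w hw]
      simp

theorem br_congr {ω ω' : Ω} (h : ω - ω' ∈ B.halfSpan) : B.br ω = B.br ω' := by
  rw [← sub_eq_zero, ← map_sub, B.br_eq_zero_of_mem h]

theorem diff_etaDel (a : 𝔤) :
    B.diff (D.etaDel cu m δ a) - D.form D.e a • B.diff (δ (cu m D.x)) ∈ B.halfSpan := by
  rw [MinimalDatum.etaDel, map_add, map_sum, Derivation.map_smul, map_add, smul_add,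
    Derivation.map_smul, map_sum, add_comm (D.form D.e a • _), ← add_assoc, add_sub_cancel_right]
  refine Submodule.add_mem _ (Submodule.sum_mem _ fun i _ => ?_)
    (Submodule.smul_of_tower_mem _ _ (Submodule.smul_of_tower_mem _ _
      (Submodule.sum_mem _ fun i _ => ?_)))
  · rw [Derivation.map_smul]
    exact Submodule.smul_of_tower_mem _ _ (B.diff_del_mem_halfSpan (D.z i).2)
  · rw [Derivation.leibniz]
    exact Submodule.add_mem _ (Submodule.smul_mem _ _ (B.diff_mem_halfSpan (D.z i).2))
      (Submodule.smul_mem _ _ (B.diff_del_mem_halfSpan (D.zStar i).2))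

theorem br_etaDel_right (ω : Ω) (b : 𝔤) :
    B.br ω (D.etaDel cu m δ b) = D.form D.e b • B.lam (B.br ω (cu m D.x)) := by
  have h0 : ∀ w ∈ gradedPiece D.h (1 / 2), B.br ω (δ (cu m w)) = 0 := fun w hw => by
    rw [B.br_del, B.br_half_right ω w hw, map_zero]
  rw [MinimalDatum.etaDel, map_add, map_sum, Derivation.map_smul, map_add,
    Derivation.map_smul, map_sum, B.br_del ω (cu m D.x), Finset.sum_eq_zero, Finset.sum_eq_zero]
  · simp
  · intro i _
    rw [Derivation.leibniz, h0 _ (D.zStar i).2, B.br_half_right ω _ (D.z i).2]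
    simp
  · intro i _
    rw [Derivation.map_smul, h0 _ (D.z i).2, smul_zero]

theorem form_e_x : D.form D.e D.x = 0 := D.form_eq_zero D.e_mem D.x_mem (by norm_num)

theorem br_smul_diff_x_x (v : A) : B.br (v • B.diff (cu m D.x)) (cu m D.x) = 0 := by
  rw [B.br_x_left, form_e_x]
  simp

theorem br_etaDel_left (a : 𝔤) (G : A) :
    B.br (B.diff (D.etaDel cu m δ a)) G =
      -(D.form D.e a • (Polynomial.X * B.br (B.diff (cu m D.x)) G)) := by
  rw [B.br_congr (B.diff_etaDel a), map_smul, Derivation.smul_apply, B.diff_del, B.br_diffDel,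
    smul_neg]

variable [FiniteDimensional ℂ 𝔤] [LieAlgebra.IsSimple ℂ 𝔤] [Module ℚ A]

theorem diff_gaugeEta (a : 𝔤) (i : ℕ) :
    B.diff (D.gaugeEta cu m a i) -
      (((B.diff : A →ₗ[ℂ] Ω) ∘ₗ cu i).liftBaseChange A (expAd (D.gauge cu m) (1 ⊗ₜ a)) +
        D.gaugeEta cu m ⁅a, D.e⁆ i • B.diff (cu m D.x)) ∈ B.halfSpan := by
  -- The differentials of `𝔤(1/2) z^m` vanish only in the quotient by `halfSpan`, so the derivation
  -- formula is applied there.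
  have h1 := D.derivation_gaugeEta cu m (B.halfSpan.mkQ.compDer B.diff) (fun w hw =>
    (Submodule.Quotient.mk_eq_zero _).2 (B.diff_mem_halfSpan hw)) a i
  have h2 : ∀ ξ : A ⊗[ℂ] 𝔤, (((B.halfSpan.mkQ.compDer B.diff : Derivation ℂ A (Ω ⧸ B.halfSpan)) :
      A →ₗ[ℂ] Ω ⧸ B.halfSpan) ∘ₗ cu i).liftBaseChange A ξ =
      B.halfSpan.mkQ (((B.diff : A →ₗ[ℂ] Ω) ∘ₗ cu i).liftBaseChange A ξ) := fun ξ => by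
    induction ξ using TensorProduct.induction_on with
    | zero => simp
    | add ξ ξ' h h' => rw [map_add, h, h', map_add, map_add]
    | tmul v a => simp
  rw [h2] at h1
  exact (Submodule.Quotient.eq _).1 h1

/-- `exp (ad N)` fixes `e` and preserves the form. Hence the bracket of `η̃_m` with `x z^m` is a
constant, free of the coefficients of `N`. -/
theorem form_e_expAd (a : 𝔤) :
    D.form.baseChange A ((1 : A) ⊗ₜ[ℂ] D.e) (expAd (D.gauge cu m) (1 ⊗ₜ a)) =
      algebraMap ℂ A (D.form D.e a) := by
  have h := baseChange_expAd (D.isNilpotent_ad_gauge cu m) D.form D.form_inv (1 ⊗ₜ D.e) (1 ⊗ₜ a)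
  rw [expAd_eq_self (D.isNilpotent_ad_gauge cu m) (D.lie_gauge_e cu m)] at h
  rw [h, LinearMap.BilinForm.baseChange_tmul, mul_one, Algebra.algebraMap_eq_smul_one]

theorem br_linear_x (a : 𝔤) (i : ℕ) :
    B.br (((B.diff : A →ₗ[ℂ] Ω) ∘ₗ cu i).liftBaseChange A (expAd (D.gauge cu m) (1 ⊗ₜ a)))
      (cu m D.x) = if i = r then Polynomial.C (algebraMap ℂ A (D.form D.e a)) else 0 := by
  rw [← form_e_expAd (cu := cu) (m := m)]
  generalize expAd (D.gauge cu m) (1 ⊗ₜ a) = ξ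
  induction ξ using TensorProduct.induction_on with
  | zero => simp
  | add ξ ξ' h h' =>
    rw [map_add, map_add, Derivation.add_apply, h, h']
    split_ifs <;> simp
  | tmul v b =>
    rw [LinearMap.liftBaseChange_tmul, LinearMap.BilinForm.baseChange_tmul, one_mul]
    exact B.br_x_right v i b

theorem br_x_linear (v : A) (b : 𝔤) (j : ℕ) :
    ((B.br (v • B.diff (cu m D.x)) : A →ₗ[ℂ] A[X]) ∘ₗ cu j).liftBaseChange A
      (expAd (D.gauge cu m) (1 ⊗ₜ b)) =
      if j = r then -Polynomial.C (D.form D.e b • v) else 0 := by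
  have : D.form D.e b • v = algebraMap ℂ A (D.form D.e b) * v := Algebra.smul_def _ _
  rw [this, ← form_e_expAd (cu := cu) (m := m)]
  generalize expAd (D.gauge cu m) (1 ⊗ₜ b) = ξ
  induction ξ using TensorProduct.induction_on with
  | zero => simp
  | add ξ ξ' h h' =>
    rw [map_add, map_add, h, h']
    split_ifs
    · rw [add_mul, map_add, neg_add]
    · rw [add_zero]
  | tmul u a =>
    rw [LinearMap.liftBaseChange_tmul, LinearMap.BilinForm.baseChange_tmul, one_mul]
    change u • B.br (v • B.diff (cu m D.x)) (cu j a) = _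
    rw [B.br_x_left]
    split_ifs
    · rw [smul_neg, Polynomial.smul_C, smul_eq_mul, mul_smul_comm, smul_mul_assoc]
    · rw [smul_zero]

theorem br_gaugeEta_right (ω : Ω) (b : 𝔤) (j : ℕ) :
    B.br ω (D.gaugeEta cu m b j) =
      ((B.br ω : A →ₗ[ℂ] A[X]) ∘ₗ cu j).liftBaseChange A (expAd (D.gauge cu m) (1 ⊗ₜ b)) +
      D.gaugeEta cu m ⁅b, D.e⁆ j • B.br ω (cu m D.x) :=
  D.derivation_gaugeEta cu m (B.br ω) (B.br_half_right ω) b j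

theorem br_gaugeEta_x (a : 𝔤) (i : ℕ) :
    B.br (B.diff (D.gaugeEta cu m a i)) (cu m D.x) =
      if i = r then Polynomial.C (algebraMap ℂ A (D.form D.e a)) else 0 := by
  rw [B.br_congr (B.diff_gaugeEta a i), map_add, Derivation.add_apply, br_smul_diff_x_x, add_zero,
    br_linear_x]

theorem br_x_gaugeEta (b : 𝔤) (j : ℕ) :
    B.br (B.diff (cu m D.x)) (D.gaugeEta cu m b j) =
      if j = r then -Polynomial.C (algebraMap ℂ A (D.form D.e b)) else 0 := by
  have h1 := B.br_smul_diff_x_x 1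
  have h2 := B.br_x_linear 1 b j
  rw [one_smul] at h1 h2
  rw [br_gaugeEta_right, h1, h2, smul_zero, add_zero, Algebra.algebraMap_eq_smul_one]

/-- The bracket splits according to whether each argument contributes its linear part or its `x z^m`
part. The contribution of `x z^m` on both sides vanishes because `(e, x) = 0`. -/
theorem br_gaugeEta (a b : 𝔤) (i j : ℕ) :
    B.br (B.diff (D.gaugeEta cu m a i)) (D.gaugeEta cu m b j) =
      B.linBr (cu i) (cu j) (expAd (D.gauge cu m) (1 ⊗ₜ a)) (expAd (D.gauge cu m) (1 ⊗ₜ b)) +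
      (if i = r then Polynomial.C (D.form D.e a • D.gaugeEta cu m ⁅b, D.e⁆ j) else 0) -
      (if j = r then Polynomial.C (D.form D.e b • D.gaugeEta cu m ⁅a, D.e⁆ i) else 0) := by
  have h1 := B.br_x_linear (D.gaugeEta cu m ⁅a, D.e⁆ i) b j
  rw [br_gaugeEta_right, br_gaugeEta_x, B.br_congr (B.diff_gaugeEta a i), map_add,
    LambdaBracket.linBr]
  have h2 : ∀ (S T : Derivation ℂ A A[X]) (ξ : A ⊗[ℂ] 𝔤),
      (((S + T : Derivation ℂ A A[X]) : A →ₗ[ℂ] A[X]) ∘ₗ cu j).liftBaseChange A ξ =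
      ((S : A →ₗ[ℂ] A[X]) ∘ₗ cu j).liftBaseChange A ξ +
      ((T : A →ₗ[ℂ] A[X]) ∘ₗ cu j).liftBaseChange A ξ := fun S T ξ => by
    induction ξ using TensorProduct.induction_on with
    | zero => simp
    | add ξ ξ' h h' => rw [map_add, h, h', map_add, map_add]; abel
    | tmul v a => simp
  rw [h2, h1]
  have h3 : D.gaugeEta cu m ⁅b, D.e⁆ j •
      (if i = r then Polynomial.C (algebraMap ℂ A (D.form D.e a)) else 0) =
      if i = r then Polynomial.C (D.form D.e a • D.gaugeEta cu m ⁅b, D.e⁆ j) else 0 := by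
    split_ifs
    · rw [Polynomial.smul_C, smul_eq_mul, mul_comm, Algebra.smul_def]
    · rw [smul_zero]
  rw [h3]
  split_ifs <;> ring

/-- `η_m(a z^j)` in terms of `η̃_m`. -/
def eta (D : MinimalDatum 𝔤) (δ : Derivation ℂ A A) (cu : ℕ → 𝔤 →ₗ[ℂ] A) (m : ℕ) (k : ℂ) (a : 𝔤)
    (j : ℕ) : A :=
  D.gaugeEta cu m a j - if j = 0 then k • D.etaDel cu m δ a else 0

/-- The `λ`-bracket of two generators `η_m`. -/
theorem br_eta (k : ℂ) (a b : 𝔤) (i j : ℕ) :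
    B.br (B.diff (eta D δ cu m k a i)) (eta D δ cu m k b j) =
      B.linBr (cu i) (cu j) (expAd (D.gauge cu m) (1 ⊗ₜ a)) (expAd (D.gauge cu m) (1 ⊗ₜ b)) +
      (if i = r then Polynomial.C (D.form D.e a • D.gaugeEta cu m ⁅b, D.e⁆ j) else 0) -
      (if j = r then Polynomial.C (D.form D.e b • D.gaugeEta cu m ⁅a, D.e⁆ i) else 0) -
      (if i = r ∧ j = 0 then (k * (D.form D.e a * D.form D.e b)) • (Polynomial.X : A[X]) else 0) -
      (if i = 0 ∧ j = r then (k * (D.form D.e a * D.form D.e b)) • (Polynomial.X : A[X])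
        else 0) := by
  have hC : ∀ c : ℂ, (Polynomial.X : A[X]) * Polynomial.C (algebraMap ℂ A c) =
      c • Polynomial.X := fun c => by
    rw [mul_comm, ← Polynomial.smul_eq_C_mul, algebraMap_smul]
  have h1 : B.br (B.diff (D.gaugeEta cu m a i)) (if j = 0 then k • D.etaDel cu m δ b else 0) =
      if i = r ∧ j = 0 then (k * (D.form D.e a * D.form D.e b)) • (Polynomial.X : A[X]) else 0 := by
    by_cases hj : j = 0
    · rw [if_pos hj, Derivation.map_smul, br_etaDel_right, br_gaugeEta_x]
      by_cases hi : i = r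
      · rw [if_pos hi, if_pos ⟨hi, hj⟩, B.lam_C, Derivation.map_algebraMap, map_zero, add_zero, hC,
          smul_smul, smul_smul, mul_comm (D.form D.e a), mul_assoc]
      · rw [if_neg hi, if_neg (fun h => hi h.1), map_zero, smul_zero, smul_zero]
    · rw [if_neg hj, if_neg (fun h => hj h.2), map_zero]
  have h2 : B.br (B.diff (if i = 0 then k • D.etaDel cu m δ a else 0)) (D.gaugeEta cu m b j) =
      if i = 0 ∧ j = r then (k * (D.form D.e a * D.form D.e b)) • (Polynomial.X : A[X]) else 0 := by
    by_cases hi : i = 0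
    · rw [if_pos hi, Derivation.map_smul, map_smul, Derivation.smul_apply, br_etaDel_left,
        br_x_gaugeEta]
      by_cases hj : j = r
      · rw [if_pos hj, if_pos ⟨hi, hj⟩, mul_neg, smul_neg, smul_neg, smul_neg, neg_neg, hC, smul_smul,
          smul_smul, mul_assoc]
      · rw [if_neg hj, if_neg (fun h => hj h.2), mul_zero, smul_zero, neg_zero, smul_zero]
    · rw [if_neg hi, if_neg (fun h => hi h.1), map_zero, map_zero, Derivation.zero_apply]
  have h3 : B.br (B.diff (if i = 0 then k • D.etaDel cu m δ a else 0))
      (if j = 0 then k • D.etaDel cu m δ b else 0) = 0 := by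
    -- Two correction terms meet only through `x z^m` with itself.
    have h4 := B.br_smul_diff_x_x 1
    rw [one_smul] at h4
    split_ifs
    · rw [Derivation.map_smul, Derivation.map_smul, br_etaDel_right, map_smul,
        Derivation.smul_apply, br_etaDel_left, h4]
      simp
    all_goals simp
  rw [eta, eta, map_sub B.diff, map_sub B.br, Derivation.sub_apply, map_sub, map_sub, h1, h2, h3,
    br_gaugeEta]
  ring

end GaugedBracket

end FracW

end

/-! ### Specialization to Lie, zero and affine values -/

noncomputable section

namespace FracW

open scoped TensorProduct Polynomial

namespace MinimalDatum

variable {𝔤 : Type*} [LieRing 𝔤] [LieAlgebra ℂ 𝔤] (D : MinimalDatum 𝔤)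

theorem form_e_of_mem {a : 𝔤} (ha : a ∈ D.geNegHalf) : D.form D.e a = 0 := by
  refine Submodule.iSup_induction _ (motive := fun a => D.form D.e a = 0) ha ?_ (map_zero _)
    fun a b h h' => by rw [map_add, h, h', add_zero]
  rintro ⟨i, hi, _⟩ b hb
  exact D.form_eq_zero D.e_mem hb (by linarith)

theorem form_e_lie_e (a : 𝔤) : D.form D.e ⁅a, D.e⁆ = 0 := by
  rw [← lie_skew, map_neg, ← D.form_inv, lie_self, map_zero, LinearMap.zero_apply, neg_zero]

theorem form_half_lie_e [FiniteDimensional ℂ 𝔤] {w : 𝔤} (hw : w ∈ gradedPiece D.h (1 / 2))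
    (a : 𝔤) : D.form w ⁅a, D.e⁆ = 0 := by
  rw [← lie_skew, map_neg, ← D.form_inv, ← lie_skew, D.lie_e_half hw, neg_zero, map_zero,
    LinearMap.zero_apply, neg_zero]

variable {A : Type*} [CommRing A] [Algebra ℂ A] (δ : Derivation ℂ A A) (cu : ℕ → 𝔤 →ₗ[ℂ] A)
  (m : ℕ)

theorem etaDel_eq_zero {a : 𝔤} (h : ∀ w ∈ gradedPiece D.h (1 / 2), D.form w a = 0)
    (he : D.form D.e a = 0) : D.etaDel cu m δ a = 0 := by
  rw [etaDel, he, zero_smul, add_zero]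
  refine Finset.sum_eq_zero fun i _ => ?_
  rw [h _ (D.zStar i).2, zero_smul]

end MinimalDatum

namespace GaugedBracket

variable {𝔤 : Type*} [LieRing 𝔤] [LieAlgebra ℂ 𝔤] {D : MinimalDatum 𝔤}
    {A Ω : Type*} [CommRing A] [Algebra ℂ A] [AddCommGroup Ω] [Module A Ω]
    [Module ℂ Ω] [IsScalarTower ℂ A Ω] {δ : Derivation ℂ A A} {cu : ℕ → 𝔤 →ₗ[ℂ] A} {m r : ℕ}
    [Module ℚ A]

theorem eta_of_ne_zero (k : ℂ) (a : 𝔤) {j : ℕ} (hj : j ≠ 0) :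
    eta D δ cu m k a j = D.gaugeEta cu m a j := by
  rw [eta, if_neg hj, sub_zero]

variable [FiniteDimensional ℂ 𝔤]

/-- Invariance makes `[a, e]` orthogonal to everything that commutes with `e`, in particular to
`𝔤(1/2)` and `e`, so no derivative terms arise. -/
theorem eta_lie_e (k : ℂ) (a : 𝔤) (j : ℕ) :
    eta D δ cu m k ⁅a, D.e⁆ j = D.gaugeEta cu m ⁅a, D.e⁆ j := by
  rw [eta, D.etaDel_eq_zero δ cu m (fun w hw => D.form_half_lie_e hw a) (D.form_e_lie_e a),
    smul_zero, ite_self, sub_zero]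

variable [LieAlgebra.IsSimple ℂ 𝔤]

theorem liftBaseChange_lie_expAd (κ : 𝔤 →ₗ[ℂ] A) (a b : 𝔤) :
    κ.liftBaseChange A ⁅expAd (D.gauge cu m) (1 ⊗ₜ a), expAd (D.gauge cu m) (1 ⊗ₜ b)⁆ =
      κ.liftBaseChange A (expAd (D.gauge cu m) (1 ⊗ₜ ⁅a, b⁆)) := by
  rw [← expAd_lie (D.isNilpotent_ad_gauge cu m), LieAlgebra.ExtendScalars.bracket_tmul, mul_one]

variable (B : GaugedBracket D A Ω δ cu m r)

/-- The `λ`-bracket of two generators `η_m`, when `{a z^i _λ b z^j} = -[a, b] z^l`. -/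
theorem br_eta_of_lie (k : ℂ) {i j l : ℕ} (hl : l ≠ 0)
    (h : ∀ (v : A) (a b : 𝔤),
      B.br (v • B.diff (cu i a)) (cu j b) = -Polynomial.C (v * cu l ⁅a, b⁆)) (a b : 𝔤) :
    B.br (B.diff (eta D δ cu m k a i)) (eta D δ cu m k b j) =
      -Polynomial.C (eta D δ cu m k ⁅a, b⁆ l) +
      (if i = r then Polynomial.C (D.form D.e a • eta D δ cu m k ⁅b, D.e⁆ j) else 0) -
      (if j = r then Polynomial.C (D.form D.e b • eta D δ cu m k ⁅a, D.e⁆ i) else 0) -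
      (if i = r ∧ j = 0 then (k * (D.form D.e a * D.form D.e b)) • (Polynomial.X : A[X]) else 0) -
      (if i = 0 ∧ j = r then (k * (D.form D.e a * D.form D.e b)) • (Polynomial.X : A[X])
        else 0) := by
  rw [br_eta, B.linBr_of_lie _ _ _ h, liftBaseChange_lie_expAd, eta_of_ne_zero k _ hl, eta_lie_e,
    eta_lie_e]
  rfl

theorem br_eta_of_zero (k : ℂ) {i j : ℕ}
    (h : ∀ (v : A) (a b : 𝔤), B.br (v • B.diff (cu i a)) (cu j b) = 0) (a b : 𝔤) :
    B.br (B.diff (eta D δ cu m k a i)) (eta D δ cu m k b j) =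
      (if i = r then Polynomial.C (D.form D.e a • eta D δ cu m k ⁅b, D.e⁆ j) else 0) -
      (if j = r then Polynomial.C (D.form D.e b • eta D δ cu m k ⁅a, D.e⁆ i) else 0) -
      (if i = r ∧ j = 0 then (k * (D.form D.e a * D.form D.e b)) • (Polynomial.X : A[X]) else 0) -
      (if i = 0 ∧ j = r then (k * (D.form D.e a * D.form D.e b)) • (Polynomial.X : A[X])
        else 0) := by
  rw [br_eta, B.linBr_of_lie (cu i) (cu j) 0 (by simp [h]), eta_lie_e, eta_lie_e]
  simp

/-- After `exp (ad N)` is removed by invariance, the leftover is `k (Ξ, [a, b])` with `Ξ` the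
logarithmic derivative: exactly the correction that turns `η̃_m([a, b])` into `η_m([a, b])`. The
hypothesis `r ≠ 0` excludes all `x z^m` terms at level zero. -/
theorem br_eta_of_affine (k : ℂ) (hr : r ≠ 0)
    (h : ∀ (v : A) (a b : 𝔤), B.br (v • B.diff (cu 0 a)) (cu 0 b) =
      Polynomial.C (v * cu 0 ⁅a, b⁆) + (k * D.form a b) • B.lam (Polynomial.C v)) (a b : 𝔤) :
    B.br (B.diff (eta D δ cu m k a 0)) (eta D δ cu m k b 0) =
      Polynomial.C (eta D δ cu m k ⁅a, b⁆ 0) + (k * D.form a b) • Polynomial.X := by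
  have hN := D.isNilpotent_ad_gauge cu m
  rw [br_eta, B.linBr_of_lie_add_form _ _ _ h, liftBaseChange_lie_expAd, if_neg hr.symm,
    if_neg hr.symm, if_neg (fun h => hr h.1.symm), if_neg (fun h => hr h.2.symm),
    D.derTensor_expAd_gauge, baseChange_expAd hN _ D.form_inv, baseChange_expAd hN _ D.form_inv,
    baseChange_lie _ D.form_inv, LieAlgebra.ExtendScalars.bracket_tmul, mul_one,
    D.baseChange_logDer, LinearMap.BilinForm.baseChange_tmul, mul_one, eta, if_pos rfl,
    MinimalDatum.gaugeEta, ← Polynomial.smul_C, map_one, mul_smul_comm, mul_one, map_sub,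
    ← Polynomial.smul_C, map_neg]
  module

end GaugedBracket

end FracW

end

/-! ### From values on variables to values on all `a z^i` -/

noncomputable section

namespace FracW

namespace MinimalDatum

variable {𝔤 : Type*} [LieRing 𝔤] [LieAlgebra ℂ 𝔤] (D : MinimalDatum 𝔤) (m : ℕ)

theorem cur_u_idx (p : D.Idx m) : D.cur m (D.u p.1.1) p.1.2 = MvPolynomial.X (p, 0) :=
  D.cur_u_of_lt m p.2

theorem C_C_mul (c : ℂ) (P : Polynomial (D.V m)) :
    Polynomial.C (MvPolynomial.C c) * P = c • P := by
  rw [← Polynomial.smul_eq_C_mul]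
  exact algebraMap_smul (D.V m) c P

section Values

variable {D m} {H : D.Idx m → D.Idx m → Polynomial (D.V m)}
  {K : ℕ → ℕ → 𝔤 →ₗ[ℂ] 𝔤 →ₗ[ℂ] Module.End ℂ (Polynomial (D.V m))}

/-- `H` is the restriction to the variables of a family of bilinear maps on all `a z^i`, `b z^j`,
which vanishes when one of these elements is a constant. -/
structure IsRestriction (H : D.Idx m → D.Idx m → Polynomial (D.V m))
    (K : ℕ → ℕ → 𝔤 →ₗ[ℂ] 𝔤 →ₗ[ℂ] Module.End ℂ (Polynomial (D.V m))) : Prop where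
  arrow_eq : ∀ p q : D.Idx m, D.arrowₗ m (H p q) = K p.1.2 q.1.2 (D.u p.1.1) (D.u q.1.1)
  left_eq_zero : ∀ i n j b, ¬ D.gr₂ i n < (D.d + 1) * m + 1 → K n j (D.u i) b = 0
  right_eq_zero : ∀ i n j a, ¬ D.gr₂ i n < (D.d + 1) * m + 1 → K j n a (D.u i) = 0

theorem IsRestriction.bracketDer_single (hK : IsRestriction H K) (p : D.Idx m) (n : ℕ)
    (v : D.V m) (b : 𝔤) (j : ℕ) :
    D.bracketDer m H (Finsupp.single (p, n) v) (D.cur m b j) =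
      K p.1.2 j (D.u p.1.1) b (((-D.lamDelₗ m) ^ n) (Polynomial.C v)) := by
  suffices ((D.bracketDer m H (Finsupp.single (p, n) v) : D.V m →ₗ[ℂ] Polynomial (D.V m)) ∘ₗ
      D.curₗ m j) = LinearMap.applyₗ (((-D.lamDelₗ m) ^ n) (Polynomial.C v)) ∘ₗ
        K p.1.2 j (D.u p.1.1) from LinearMap.congr_fun this b
  refine D.u.ext fun β => ?_
  change D.bracketDer m H (Finsupp.single (p, n) v) (D.cur m (D.u β) j) =
    K p.1.2 j (D.u p.1.1) (D.u β) (((-D.lamDelₗ m) ^ n) (Polynomial.C v))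
  by_cases h : D.gr₂ β j < (D.d + 1) * m + 1
  · rw [D.cur_u_of_lt m h, bracketDer_X, pow_zero, Module.End.one_apply, bracketVar_single,
      hK.arrow_eq]
  · obtain ⟨c, hc⟩ := D.cur_u_of_not_lt m h
    rw [hc, MvPolynomial.derivation_C, hK.right_eq_zero β j _ _ h, LinearMap.zero_apply]

/-- By linearity one may take `a` in the basis. A class that is not a variable is a constant, killed
by every derivation, and there `K` vanishes too. -/
theorem IsRestriction.bracketDer_cur (hK : IsRestriction H K) (v : D.V m) (a b : 𝔤) (i j : ℕ) :
    D.bracketDer m H (v • D.dK m (D.cur m a i)) (D.cur m b j) = K i j a b (Polynomial.C v) := by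
  let T : 𝔤 →ₗ[ℂ] Polynomial (D.V m) :=
    { toFun := fun a => D.bracketDer m H (v • D.dK m (D.curₗ m i a)) (D.cur m b j)
      map_add' := fun a a' => by simp only [map_add, smul_add, Derivation.add_apply]
      map_smul' := fun c a => by
        rw [(D.curₗ m i).map_smul, Derivation.map_smul,
          smul_comm v c (D.dK m (D.curₗ m i a) : D.Kahler m), (D.bracketDer m H).map_smul]
        rfl }
  suffices T = LinearMap.applyₗ (Polynomial.C v) ∘ₗ (K i j).flip b from LinearMap.congr_fun this a
  refine D.u.ext fun α => ?_
  change D.bracketDer m H (v • D.dK m (D.cur m (D.u α) i)) (D.cur m b j) =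
    K i j (D.u α) b (Polynomial.C v)
  by_cases h : D.gr₂ α i < (D.d + 1) * m + 1
  · have hX : D.cur m (D.u α) i = _ := D.cur_u_idx m ⟨(α, i), h⟩
    rw [hX, dK_X, Finsupp.smul_single, smul_eq_mul, mul_one]
    exact hK.bracketDer_single ⟨(α, i), h⟩ 0 v b j
  · obtain ⟨c, hc⟩ := D.cur_u_of_not_lt m h
    rw [hc, MvPolynomial.derivation_C, smul_zero, map_zero, hK.left_eq_zero α i _ _ h,
      LinearMap.zero_apply, Derivation.zero_apply]

theorem IsRestriction.bracketDer_right_eq_zero (hK : IsRestriction H K) {b : 𝔤} {j : ℕ}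
    (h : ∀ i a, K i j a b = 0) (ω : D.Kahler m) : D.bracketDer m H ω (D.cur m b j) = 0 := by
  induction ω using Finsupp.induction_linear with
  | zero => rw [map_zero, Derivation.zero_apply]
  | add ω ω' h h' => rw [map_add, Derivation.add_apply, h, h', add_zero]
  | single p v =>
    obtain ⟨p, n⟩ := p
    rw [hK.bracketDer_single, h, LinearMap.zero_apply]

theorem IsRestriction.bracketDer_left_eq_zero (hK : IsRestriction H K) {a : 𝔤} {i : ℕ}
    (h : ∀ j b, K i j a b = 0) (v : D.V m) : D.bracketDer m H (v • D.dK m (D.cur m a i)) = 0 := by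
  refine MvPolynomial.derivation_ext fun q => ?_
  have h1 := hK.bracketDer_cur v a (D.u q.1.1.1) i q.1.1.2
  rw [h, LinearMap.zero_apply, D.cur_u_idx, bracketDer_X, pow_zero,
    Module.End.one_apply] at h1
  rw [bracketDer_X, h1, map_zero, Derivation.zero_apply]

end Values

/-- `(a, b) ↦ κ [a, b]`, acting by multiplication. -/
def lieOp (κ : 𝔤 →ₗ[ℂ] D.V m) : 𝔤 →ₗ[ℂ] 𝔤 →ₗ[ℂ] Module.End ℂ (Polynomial (D.V m)) :=
  LinearMap.mk₂ ℂ (fun a b => LinearMap.mulLeft ℂ (Polynomial.C (κ ⁅a, b⁆)))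
    (fun a a' b => by ext1; simp [add_mul]) (fun c a b => by ext1; simp [← Polynomial.smul_C])
    (fun a b b' => by ext1; simp [add_mul]) (fun c a b => by ext1; simp [← Polynomial.smul_C])

theorem lieOp_apply (κ : 𝔤 →ₗ[ℂ] D.V m) (a b : 𝔤) :
    D.lieOp m κ a b = LinearMap.mulLeft ℂ (Polynomial.C (κ ⁅a, b⁆)) := rfl

/-- The values of the first bracket. -/
def val₁ (i j : ℕ) : 𝔤 →ₗ[ℂ] 𝔤 →ₗ[ℂ] Module.End ℂ (Polynomial (D.V m)) :=
  D.lieOp m (-D.curₗ m (i + j + 1))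

/-- The values of the second bracket. -/
def val₂ (k : ℂ) (i j : ℕ) : 𝔤 →ₗ[ℂ] 𝔤 →ₗ[ℂ] Module.End ℂ (Polynomial (D.V m)) :=
  if i = 0 ∧ j = 0 then
    D.lieOp m (D.curₗ m 0) + D.form.compr₂ (LinearMap.toSpanSingleton ℂ _ (k • D.lamDelₗ m))
  else if i = 0 ∨ j = 0 then 0 else D.lieOp m (-D.curₗ m (i + j))

variable {D m} in
theorem lieOp_eq_zero {l : ℕ} {a b : 𝔤} (h : D.cur m ⁅a, b⁆ l = 0) :
    D.lieOp m (-D.curₗ m l) a b = 0 := by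
  rw [lieOp_apply, LinearMap.neg_apply, curₗ_apply, h, neg_zero, map_zero,
    LinearMap.mulLeft_zero_eq_zero]

variable {D m} in
theorem cur_lie_eq_zero_comm {l : ℕ} {a b : 𝔤} (h : D.cur m ⁅a, b⁆ l = 0) :
    D.cur m ⁅b, a⁆ l = 0 := by
  rw [← lie_skew, ← curₗ_apply, map_neg, curₗ_apply, h, neg_zero]

theorem val₂_zero_zero (k : ℂ) (a b : 𝔤) (P : Polynomial (D.V m)) :
    D.val₂ m k 0 0 a b P =
      Polynomial.C (D.cur m ⁅a, b⁆ 0) * P + (k * D.form a b) • D.lamDelₗ m P := by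
  rw [val₂, if_pos ⟨rfl, rfl⟩, mul_comm k, mul_smul]
  rfl

theorem val₂_of_eq_zero (k : ℂ) {i j : ℕ} (h : i = 0 ∨ j = 0) (h' : ¬ (i = 0 ∧ j = 0)) :
    D.val₂ m k i j = 0 := by
  rw [val₂, if_neg h', if_pos h]

theorem val₂_of_ne_zero (k : ℂ) {i j : ℕ} (h : ¬ (i = 0 ∨ j = 0)) :
    D.val₂ m k i j = D.lieOp m (-D.curₗ m (i + j)) := by
  rw [val₂, if_neg (fun h' => h (Or.inl h'.1)), if_neg h]

variable [FiniteDimensional ℂ 𝔤]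

theorem gr₂_zero_lt {m : ℕ} (hm : 0 < m) (i : Fin (Module.finrank ℂ 𝔤)) :
    D.gr₂ i 0 < (D.d + 1) * m + 1 := by
  have := D.wt_le_one i
  have hm' : (0 : ℚ) < m := by exact_mod_cast hm
  rw [gr₂, D.d_eq_one]
  push_cast
  linarith

variable [LieAlgebra.IsSimple ℂ 𝔤]

theorem isRestriction₁ : IsRestriction (D.gen₁ m) (D.val₁ m) where
  arrow_eq p q := by
    rw [gen₁, arrowₗ_C]
    rfl
  left_eq_zero i n j b h := lieOp_eq_zero (D.cur_lie_eq_zero m h (by omega) b)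
  right_eq_zero i n j a h :=
    lieOp_eq_zero (cur_lie_eq_zero_comm (D.cur_lie_eq_zero m h (by omega) a))

theorem isRestriction₂ {m : ℕ} (hm : 0 < m) (k : ℂ) :
    IsRestriction (D.gen₂ m k) (D.val₂ m k) where
  arrow_eq p q := by
    rw [gen₂, val₂]
    split_ifs
    · rw [arrowₗ_C_add]
      refine LinearMap.ext fun P => ?_
      change _ + Polynomial.C (MvPolynomial.C _) * _ = _ + D.form _ _ • k • D.lamDelₗ m P
      rw [C_C_mul, mul_comm k, mul_smul]
      rfl
    · rw [arrowₗ_zero]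
      rfl
    · rw [arrowₗ_C]
      rfl
  left_eq_zero i n j b h := by
    -- For `m > 0` every `u_i z^0` is a variable, so a constant never meets the affine case.
    have hn : n ≠ 0 := fun h0 => h (by rw [h0]; exact D.gr₂_zero_lt hm i)
    by_cases hj : j = 0
    · rw [D.val₂_of_eq_zero m k (Or.inr hj) fun h0 => hn h0.1]
      rfl
    · rw [D.val₂_of_ne_zero m k (not_or.2 ⟨hn, hj⟩)]
      exact lieOp_eq_zero (D.cur_lie_eq_zero m h (by omega) b)
  right_eq_zero i n j a h := by
    have hn : n ≠ 0 := fun h0 => h (by rw [h0]; exact D.gr₂_zero_lt hm i)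
    by_cases hj : j = 0
    · rw [D.val₂_of_eq_zero m k (Or.inl hj) fun h0 => hn h0.2]
      rfl
    · rw [D.val₂_of_ne_zero m k (not_or.2 ⟨hj, hn⟩)]
      exact lieOp_eq_zero (cur_lie_eq_zero_comm (D.cur_lie_eq_zero m h (by omega) a))

end MinimalDatum

end FracW

end

/-! ### The two brackets as gauged brackets, and the brackets of the `η_m` -/

noncomputable section

namespace FracW

namespace MinimalDatum

variable {𝔤 : Type*} [LieRing 𝔤] [LieAlgebra ℂ 𝔤] (D : MinimalDatum 𝔤) (m : ℕ)

/-- The `λ`-bracket on `𝒱` with values `H` on the variables. -/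
def lambdaBracket (H : D.Idx m → D.Idx m → Polynomial (D.V m)) :
    LambdaBracket (D.V m) (D.Kahler m) (D.del m) where
  lam := D.lamDelₗ m
  lam_C := D.lamDelₗ_C m
  diff := D.dK m
  diffDel := D.delK m
  diff_del := D.dK_del m
  diffDel_smul := D.delK_smul m
  br := D.bracketDer m H
  br_del := D.bracketDer_del m H
  br_diffDel := D.bracketDer_delK m H

section Values

variable {D m} {H : D.Idx m → D.Idx m → Polynomial (D.V m)}
  {K : ℕ → ℕ → 𝔤 →ₗ[ℂ] 𝔤 →ₗ[ℂ] Module.End ℂ (Polynomial (D.V m))}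

theorem IsRestriction.bracketDer_of_lie (hK : IsRestriction H K) {i j l : ℕ}
    (h : K i j = D.lieOp m (-D.curₗ m l)) (v : D.V m) (a b : 𝔤) :
    D.bracketDer m H (v • D.dK m (D.cur m a i)) (D.cur m b j) =
      -Polynomial.C (v * D.cur m ⁅a, b⁆ l) := by
  rw [hK.bracketDer_cur, h]
  change Polynomial.C (-D.cur m ⁅a, b⁆ l) * Polynomial.C v = _
  rw [← Polynomial.C_mul, ← Polynomial.C_neg]
  congr 1
  ring

variable [FiniteDimensional ℂ 𝔤] [LieAlgebra.IsSimple ℂ 𝔤]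

/-- A `λ`-bracket of level `r`: at levels at least `r` in one argument, it is
`{a z^i _λ b z^j} = -[a, b] z^{i+j+1-r}`, and it vanishes between higher and lower levels. -/
theorem IsRestriction.exists_gaugedBracket (hK : IsRestriction H K) {r : ℕ}
    (hm : r ≤ m) (hl : ∀ i j l, r ≤ i → r ≤ j → l + r = i + j + 1 →
      K i j = D.lieOp m (-D.curₗ m l))
    (h0 : ∀ i j, i < r → r ≤ j → K i j = 0) (h0' : ∀ i j, j < r → r ≤ i → K i j = 0) :
    ∃ B : GaugedBracket D (D.V m) (D.Kahler m) (D.del m) (D.curₗ m) m r,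
      B.toLambdaBracket = D.lambdaBracket m H := by
  have hhalf : ∀ w ∈ gradedPiece D.h (1 / 2), ∀ j b, K m j w b = 0 := fun w hw j b => by
    rcases Nat.lt_or_ge j r with hj | hj
    · rw [h0' m j hj hm]
      rfl
    -- As `j ≥ r`, the resulting level is at least `m + 1`, where `𝔤(1/2)` contributes nothing.
    · rw [hl m j (m + j + 1 - r) hm hj (by omega)]
      exact lieOp_eq_zero (D.cur_lie_half m hw b (by omega))
  have hhalf' : ∀ w ∈ gradedPiece D.h (1 / 2), ∀ i a, K i m a w = 0 := fun w hw i a => by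
    rcases Nat.lt_or_ge i r with hi | hi
    · rw [h0 i m hi hm]
      rfl
    · rw [hl i m (i + m + 1 - r) hi hm (by omega)]
      exact lieOp_eq_zero (cur_lie_eq_zero_comm (D.cur_lie_half m hw a (by omega)))
  refine ⟨{ D.lambdaBracket m H with
    br_half_right := fun ω w hw => hK.bracketDer_right_eq_zero (hhalf' w hw) ω
    br_half_left := fun v w hw => hK.bracketDer_left_eq_zero (hhalf w hw) v
    br_x_right := fun v i a => ?_
    br_x_left := fun v j b => ?_ }, rfl⟩
  · change D.bracketDer m H (v • D.dK m (D.cur m a i)) (D.cur m D.x m) = _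
    rcases Nat.lt_or_ge i r with hi | hi
    · rw [hK.bracketDer_cur, h0 i m hi hm, if_neg hi.ne]
      rfl
    rw [hK.bracketDer_of_lie (hl i m (i + m + 1 - r) hi hm (by omega)), ← lie_skew,
      ← curₗ_apply, map_neg, curₗ_apply]
    split_ifs with h
    -- Only `i = r` reaches level `m + 1`, where the constant `-(e, ·)` lives; larger `i` land on
    -- zero.
    · rw [show i + m + 1 - r = m + 1 by omega, cur_lie_x, ← Polynomial.C_neg,
        MvPolynomial.smul_eq_C_mul]
      congr 1
      ring
    · rw [D.cur_eq_zero m (by omega)]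
      simp
  · change D.bracketDer m H (v • D.dK m (D.cur m D.x m)) (D.cur m b j) = _
    rcases Nat.lt_or_ge j r with hj | hj
    · rw [hK.bracketDer_cur, h0' m j hj hm, if_neg hj.ne]
      rfl
    rw [hK.bracketDer_of_lie (hl m j (m + j + 1 - r) hm hj (by omega))]
    split_ifs with h
    · rw [show m + j + 1 - r = m + 1 by omega, cur_lie_x, MvPolynomial.smul_eq_C_mul, mul_comm v]
    · rw [D.cur_eq_zero m (by omega)]
      simp

end Values

variable [FiniteDimensional ℂ 𝔤] [LieAlgebra.IsSimple ℂ 𝔤]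

theorem etaTilde_eq_gaugeEta (a : 𝔤) (j : ℕ) :
    D.etaTilde m a j = D.gaugeEta (D.curₗ m) m a j := by
  rw [gaugeEta_eq_sum, etaTilde]
  simp only [MvPolynomial.smul_eq_C_mul, mul_assoc, curₗ_apply]

theorem eta_eq (k : ℂ) (a : 𝔤) (j : ℕ) :
    D.eta m k a j = GaugedBracket.eta D (D.del m) (D.curₗ m) m k a j := by
  have h : ∀ (c : ℂ) (P Q : D.V m), MvPolynomial.C c *
      (MvPolynomial.C k * P + MvPolynomial.C (k / 2) * Q) = k • c • (P + (1 / 2 : ℂ) • Q) :=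
    fun c P Q => by
      rw [← MvPolynomial.smul_eq_C_mul, ← MvPolynomial.smul_eq_C_mul, ← MvPolynomial.smul_eq_C_mul,
        div_eq_mul_one_div, mul_smul, ← smul_add, smul_comm]
  rw [eta, GaugedBracket.eta, etaTilde_eq_gaugeEta, etaDel, h]
  have h' : ∀ i, MvPolynomial.C (D.form (D.zStar i) a * k) * D.del m (D.cur m (D.z i) m) =
      k • D.form (D.zStar i) a • D.del m (D.curₗ m m (D.z i)) := fun i => by
    rw [← MvPolynomial.smul_eq_C_mul, mul_comm, mul_smul]
    rfl
  simp only [h']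
  rw [← Finset.smul_sum, ← smul_add]
  rfl

theorem eta_smul (k c : ℂ) (a : 𝔤) (j : ℕ) : D.eta m k (c • a) j = c • D.eta m k a j := by
  simp only [eta_eq, GaugedBracket.eta, gaugeEta, etaDel, TensorProduct.tmul_smul,
    LinearMap.map_smul_of_tower, map_smul, smul_eq_mul, mul_smul, ← Finset.smul_sum, smul_add]
  split_ifs
  · simp only [smul_sub, smul_add]
    rw [smul_comm k c, smul_comm k c, smul_comm k c]
  · simp

theorem eta_zero (k : ℂ) (j : ℕ) : D.eta m k 0 j = 0 := by
  simpa using D.eta_smul m k 0 0 j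

variable {m}

/-- The first bracket of two generators `η_m`. -/
theorem bracket₁_eta (k : ℂ) (a b : 𝔤) (i j : ℕ) :
    D.bracket₁ m (D.eta m k a i) (D.eta m k b j) =
      -Polynomial.C (D.eta m k ⁅a, b⁆ (i + j + 1)) +
      (if i = 0 then Polynomial.C (D.form D.e a • D.eta m k ⁅b, D.e⁆ j) else 0) -
      (if j = 0 then Polynomial.C (D.form D.e b • D.eta m k ⁅a, D.e⁆ i) else 0) -
      (if i = 0 ∧ j = 0 then (k * (D.form D.e a * D.form D.e b)) • Polynomial.X else 0) -
      (if i = 0 ∧ j = 0 then (k * (D.form D.e a * D.form D.e b)) • Polynomial.X else 0) := by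
  obtain ⟨B, hB⟩ := (D.isRestriction₁ m).exists_gaugedBracket (Nat.zero_le m)
    (fun i j l _ _ h => by rw [val₁, ← h, add_zero]) (fun i j h => absurd h (Nat.not_lt_zero i))
    (fun i j h => absurd h (Nat.not_lt_zero j))
  rw [bracket₁, lamBracket_eq]
  simp only [eta_eq]
  have h := B.br_eta_of_lie k (l := i + j + 1) (i := i) (j := j) (Nat.succ_ne_zero _) (by
    rw [hB]
    exact (D.isRestriction₁ m).bracketDer_of_lie rfl) a b
  rw [hB] at h
  exact h

theorem exists_gaugedBracket₂ (hm : 0 < m) (k : ℂ) :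
    ∃ B : GaugedBracket D (D.V m) (D.Kahler m) (D.del m) (D.curₗ m) m 1,
      B.toLambdaBracket = D.lambdaBracket m (D.gen₂ m k) := by
  refine (D.isRestriction₂ hm k).exists_gaugedBracket hm (fun i j l hi hj h => ?_)
    (fun i j hi hj => ?_) fun i j hj hi => ?_
  · rw [D.val₂_of_ne_zero m k (by omega), Nat.succ.inj h]
  · rw [D.val₂_of_eq_zero m k (by omega) (by omega)]
  · rw [D.val₂_of_eq_zero m k (by omega) (by omega)]

/-- The second bracket of two generators `η_m` of positive degree in `z`. -/
theorem bracket₂_eta_of_pos (hm : 0 < m) (k : ℂ) (a b : 𝔤) {i j : ℕ} (hi : 0 < i) (hj : 0 < j) :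
    D.bracket₂ m k (D.eta m k a i) (D.eta m k b j) =
      -Polynomial.C (D.eta m k ⁅a, b⁆ (i + j)) +
      (if i = 1 then Polynomial.C (D.form D.e a • D.eta m k ⁅b, D.e⁆ j) else 0) -
      (if j = 1 then Polynomial.C (D.form D.e b • D.eta m k ⁅a, D.e⁆ i) else 0) := by
  obtain ⟨B, hB⟩ := D.exists_gaugedBracket₂ hm k
  rw [bracket₂, lamBracket_eq]
  simp only [eta_eq]
  have h := B.br_eta_of_lie k (l := i + j) (i := i) (j := j) (by omega) (by
    rw [hB]
    exact (D.isRestriction₂ hm k).bracketDer_of_lie (D.val₂_of_ne_zero m k (by omega))) a b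
  rw [hB, if_neg (c := i = 1 ∧ j = 0) (by omega), if_neg (c := i = 0 ∧ j = 1) (by omega), sub_zero,
    sub_zero] at h
  exact h

/-- The second bracket of `η_m(a z)` and `η_m(b)`. -/
theorem bracket₂_eta_one_zero (hm : 0 < m) (k : ℂ) (a b : 𝔤) :
    D.bracket₂ m k (D.eta m k a 1) (D.eta m k b 0) =
      Polynomial.C (D.form D.e a • D.eta m k ⁅b, D.e⁆ 0) -
        (k * (D.form D.e a * D.form D.e b)) • Polynomial.X := by
  obtain ⟨B, hB⟩ := D.exists_gaugedBracket₂ hm k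
  rw [bracket₂, lamBracket_eq]
  simp only [eta_eq]
  have h := B.br_eta_of_zero k (i := 1) (j := 0) (by
    rw [hB]
    intro v a b
    change D.bracketDer m _ (v • D.dK m (D.cur m a 1)) (D.cur m b 0) = 0
    rw [(D.isRestriction₂ hm k).bracketDer_cur,
      D.val₂_of_eq_zero m k (by omega) (by omega)]
    rfl) a b
  rw [hB, if_pos rfl, if_neg (by omega), if_pos (by omega), if_neg (by omega), sub_zero,
    sub_zero] at h
  exact h

/-- The second bracket of `η_m(a)` and `η_m(b)`. -/
theorem bracket₂_eta_zero_zero (hm : 0 < m) (k : ℂ) (a b : 𝔤) :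
    D.bracket₂ m k (D.eta m k a 0) (D.eta m k b 0) =
      Polynomial.C (D.eta m k ⁅a, b⁆ 0) + (k * D.form a b) • Polynomial.X := by
  obtain ⟨B, hB⟩ := D.exists_gaugedBracket₂ hm k
  rw [bracket₂, lamBracket_eq]
  simp only [eta_eq]
  have h := B.br_eta_of_affine k one_ne_zero (by
    rw [hB]
    intro v a b
    change D.bracketDer m _ (v • D.dK m (D.cur m a 0)) (D.cur m b 0) = _
    rw [(D.isRestriction₂ hm k).bracketDer_cur, val₂_zero_zero, ← Polynomial.C_mul, mul_comm v]
    rfl) a b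
  rw [hB] at h
  exact h

end MinimalDatum

end FracW

end

/-! ### Evaluation at `f` and on `𝔤'` -/

theorem mainTheorem8 {𝔤 : Type*} [LieRing 𝔤] [LieAlgebra ℂ 𝔤] [FiniteDimensional ℂ 𝔤]
    [LieAlgebra.IsSimple ℂ 𝔤] (D : FracW.MinimalDatum 𝔤) (k : ℂ) (m : ℕ) (hm : 0 < m) :
    -- the first bracket
    (D.bracket₁ m (D.eta m k D.f 0) (D.eta m k D.f 0) =
        Polynomial.C (MvPolynomial.C (-2 * k)) * Polynomial.X) ∧
    (∀ (a : 𝔤) (i : ℕ), (i = 0 → a ∈ D.geNegHalf) →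
      D.bracket₁ m (D.eta m k D.f 0) (D.eta m k a i) =
        Polynomial.C (-D.eta m k ⁅D.f, a⁆ (i + 1) + D.eta m k ⁅a, D.e⁆ i)) ∧
    (∀ (a : 𝔤) (i : ℕ), (i = 0 → a ∈ D.geNegHalf) →
      D.bracket₁ m (D.eta m k a i) (D.eta m k D.f 0) =
        Polynomial.C (-D.eta m k ⁅a, D.f⁆ (i + 1) - D.eta m k ⁅a, D.e⁆ i)) ∧
    (∀ (a b : 𝔤) (i j : ℕ), (i = 0 → a ∈ D.geNegHalf) → (j = 0 → b ∈ D.geNegHalf) →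
      D.bracket₁ m (D.eta m k a i) (D.eta m k b j) =
        Polynomial.C (-D.eta m k ⁅a, b⁆ (i + j + 1))) ∧
    -- the second bracket
    (∀ a b : 𝔤,
      D.bracket₂ m k (D.eta m k a 0) (D.eta m k b 0) =
        Polynomial.C (D.eta m k ⁅a, b⁆ 0) +
          Polynomial.C (MvPolynomial.C (k * D.form a b)) * Polynomial.X) ∧
    (D.bracket₂ m k (D.eta m k D.f 1) (D.eta m k D.f 0) =
        Polynomial.C (-2 * D.eta m k D.x 0) -
          Polynomial.C (MvPolynomial.C k) * Polynomial.X) ∧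
    (∀ a ∈ D.geNegHalf,
      D.bracket₂ m k (D.eta m k D.f 1) (D.eta m k a 0) =
        Polynomial.C (D.eta m k ⁅a, D.e⁆ 0)) ∧
    (D.bracket₂ m k (D.eta m k D.f 1) (D.eta m k D.f 1) = 0) ∧
    (∀ (a : 𝔤) (i : ℕ), 0 < i → (i = 1 → a ∈ D.geNegHalf) →
      D.bracket₂ m k (D.eta m k D.f 1) (D.eta m k a i) =
        Polynomial.C (-D.eta m k ⁅D.f, a⁆ (i + 1) + D.eta m k ⁅a, D.e⁆ i)) ∧
    (∀ (a : 𝔤) (i : ℕ), 0 < i → (i = 1 → a ∈ D.geNegHalf) →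
      D.bracket₂ m k (D.eta m k a i) (D.eta m k D.f 1) =
        Polynomial.C (-D.eta m k ⁅a, D.f⁆ (i + 1) - D.eta m k ⁅a, D.e⁆ i)) ∧
    (∀ (a b : 𝔤) (i j : ℕ), 0 < i → 0 < j → (i = 1 → a ∈ D.geNegHalf) →
      (j = 1 → b ∈ D.geNegHalf) →
      D.bracket₂ m k (D.eta m k a i) (D.eta m k b j) =
        Polynomial.C (-D.eta m k ⁅a, b⁆ (i + j))) := by
  have hskew : ⁅D.f, D.e⁆ = -(2 : ℂ) • D.x := by
    rw [← lie_skew, D.triple.lie_e_f, FracW.MinimalDatum.x, smul_smul]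
    norm_num
  have h0 : ∀ {a : 𝔤}, a ∈ D.geNegHalf → D.form D.e a = 0 := D.form_e_of_mem
  have hX : ∀ c : ℂ, Polynomial.C (MvPolynomial.C c) * (Polynomial.X : Polynomial (D.V m)) =
      c • Polynomial.X := fun c => D.C_C_mul m c _
  have key : ∀ {a : 𝔤} {i r : ℕ} (P : D.V m), (i = r → a ∈ D.geNegHalf) →
      (if i = r then Polynomial.C (D.form D.e a • P) else 0) = 0 := fun P h => by
    split_ifs with hi
    · rw [h0 (h hi), zero_smul, map_zero]
    · rfl
  have key' : ∀ {a : 𝔤} {p q : Prop} [Decidable (p ∧ q)] (c : ℂ), (p → q → a ∈ D.geNegHalf) →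
      (if p ∧ q then (k * (c * D.form D.e a)) • (Polynomial.X : Polynomial (D.V m)) else 0) = 0 :=
    fun c h => by
      split_ifs with hi
      · rw [h0 (h hi.1 hi.2), mul_zero, mul_zero, zero_smul]
      · rfl
  refine ⟨?_, fun a i ha => ?_, fun a i ha => ?_, fun a b i j ha hb => ?_, fun a b => ?_, ?_,
    fun a ha => ?_, ?_, fun a i hi ha => ?_, fun a i hi ha => ?_, fun a b i j hi hj ha hb => ?_⟩
  -- The two `[f, e]` terms cancel, and each of the two correction terms contributes `-kλ`.
  · rw [D.bracket₁_eta, hX, lie_self, D.eta_zero]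
    simp only [D.form_e_f, one_smul, if_true, and_self, mul_one, map_zero, neg_zero, zero_add,
      sub_self, zero_sub]
    rw [neg_mul, two_mul, neg_smul, add_smul]
    ring
  · rw [D.bracket₁_eta, key _ ha, key' _ (fun _ => ha), if_pos rfl, D.form_e_f, one_smul, zero_add,
      sub_zero, sub_zero, sub_zero, Polynomial.C_add, Polynomial.C_neg]
  · rw [D.bracket₁_eta, key _ ha, mul_comm (D.form D.e a), key' _ (fun h _ => ha h), if_pos rfl,
      D.form_e_f, one_smul, add_zero, add_zero, sub_zero, sub_zero, Polynomial.C_sub,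
      Polynomial.C_neg]
  · rw [D.bracket₁_eta, key _ ha, key _ hb, key' _ (fun _ => hb), add_zero, sub_zero, sub_zero,
      sub_zero, Polynomial.C_neg]
  · rw [D.bracket₂_eta_zero_zero hm, hX]
  · rw [D.bracket₂_eta_one_zero hm, hX, hskew, D.eta_smul, D.form_e_f, one_smul, mul_one, mul_one,
      neg_smul, MvPolynomial.smul_eq_C_mul, neg_mul]
    rfl
  · rw [D.bracket₂_eta_one_zero hm, h0 ha, D.form_e_f, one_smul, mul_zero, mul_zero, zero_smul,
      sub_zero]
  · rw [D.bracket₂_eta_of_pos hm k _ _ one_pos one_pos, lie_self, D.eta_zero, if_pos rfl,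
      map_zero, neg_zero, zero_add, sub_self]
  · rw [D.bracket₂_eta_of_pos hm k _ _ one_pos hi, key _ ha, if_pos rfl, D.form_e_f, one_smul,
      sub_zero, Polynomial.C_add, Polynomial.C_neg, add_comm 1 i]
  · rw [D.bracket₂_eta_of_pos hm k _ _ hi one_pos, key _ ha, if_pos rfl, D.form_e_f, one_smul,
      add_zero, Polynomial.C_sub, Polynomial.C_neg]
  · rw [D.bracket₂_eta_of_pos hm k a b hi hj, key _ ha, key _ hb, add_zero, sub_zero,
      Polynomial.C_neg]
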